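/- Consider the linearized classical Boussinesq system on the half-line $$r_t+q_x=0,\qquad q_t+r_x-q_{xxt}=0\qquad (x>0,\ t>0),$$ with initial conditions $r(x,0)=r_0(x)$, $q(x,0)=q_0(x)$ for $x\ge 0$ and boundary condition $q(0,t)=g_0(t)$ for $t\ge 0$. Suppose that $(r,q)$ is a (complex-valued) solution such that $r,q$ are $C^\infty$ on $[0,\infty)\times[0,\infty)$ and decay as $x\to\infty$ in the following sense: for all $a\le 3$, $b\le 1$ and $T>0$, the derivatives $\partial_x^a\partial_t^b r$ and $\partial_x^a\partial_t^b q$ are $O((1+x)^{-2})$ uniformly for $0<t\le T$. Notation. Let $\hat f(k)=\int_0^\infty e^{-ikx}f(x)\,dx$ for $\operatorname{Im}k\le 0$ and $\widetilde f(\omega,t)=\int_0^t e^{-i\omega\tau}f(\tau)\,d\tau$. Let $\mu(k)=(1+k^2)^{1/2}$ be the branch with branch cut $i[-1,1]$ and $\mu(k)\sim k$ as $|k|\to\infty$ (on the cut, the limit from the right), that is $\mu(k)=\sqrt{|1+k^2|}\,e^{i(\theta_1+\theta_2-\pi)/2}$, where $\theta_1,\theta_2\in[0,2\pi)$ are the angles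 of $k+i$ and $k-i$ measured counterclockwise from the direction $-i$. Let $\omega=\omega(k)=k/\mu(k)$. Let $\mathcal C$ be any piecewise $C^1$ closed curve of finite length in the open upper half-plane that does not pass through $i$ and winds once counterclockwise around $i$. Then for all $x>0$ and $t\ge 0$ $$\begin{aligned} r(x,t)={}&\frac1{2\pi}\int_{\mathbb R}e^{ikx}\,\tfrac12\Big[(e^{i\omega t}+e^{-i\omega t})\hat r_0(k)-\mu(k)(e^{i\omega t}-e^{-i\omega t})\hat q_0(k)\Big]dk\\ &+\frac1{2\pi}\int_{\mathcal C}e^{ikx}\,\tfrac12\Big[(e^{i\omega t}+e^{-i\omega t})\hat r_0(-k)+\mu(k)(e^{i\omega t}-e^{-i\omega t})\hat q_0(-k)\Big]dk\\ &+\frac1{2\pi}\int_{\mathcal C}e^{ikx}\Big\{\big[e^{i\omega t}\widetilde g_0(\omega,t)+e^{-i\omega t}\widetilde g_0(-\omega,t)\big]+i\omega(k)\big[e^{i\omega t}\widetilde{g_0'}(\omega,t)-e^{-i\omega t}\widetilde{g_0'}(-\omega,t)\big]\Big\}dk \end{aligned}$$ and $$\begin{aligned} q(x,t)={}&\frac1{2\pi}\int_{\mathbb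 R}e^{ikx}\,\tfrac12\Big[(e^{i\omega t}+e^{-i\omega t})\hat q_0(k)-\tfrac1{\mu(k)}(e^{i\omega t}-e^{-i\omega t})\hat r_0(k)\Big]dk\\ &-\frac1{2\pi}\int_{\mathcal C}e^{ikx}\,\tfrac12\Big[(e^{i\omega t}+e^{-i\omega t})\hat q_0(-k)+\tfrac1{\mu(k)}(e^{i\omega t}-e^{-i\omega t})\hat r_0(-k)\Big]dk\\ &-\frac1{2\pi}\int_{\mathcal C}e^{ikx}\Big\{\tfrac1{\mu(k)}\big[e^{i\omega t}\widetilde g_0(\omega,t)-e^{-i\omega t}\widetilde g_0(-\omega,t)\big]+\tfrac{ik}{1+k^2}\big[e^{i\omega t}\widetilde{g_0'}(\omega,t)+e^{-i\omega t}\widetilde{g_0'}(-\omega,t)\big]\Big\}dk. \end{aligned}$$ Here the integral over $\mathbb R$ in the formula for $q$ converges as an improper integral $\lim_{a\to-\infty,\,b\to\infty}\int_a^b$. The integral over $\mathbb R$ in the formula for $r$ exists in the sense of Abel, i.e. as $\lim_{\varepsilon\to0^+}\int_{\mathbb R}e^{-\varepsilon|k|}(\cdots)\,dk$, and it converges as an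 improper integral, with the same value, whenever $q_0(0)\sin t=0$ (in particular whenever $q_0(0)=0$). -/

import Mathlib

open Complex Set Filter Topology MeasureTheory
open scoped ContDiff

noncomputable section

namespace LinearBoussinesq

/-- The mixed partial derivative `∂ₜᵇ ∂ₓᵃ u` at the point `(x, t)`. -/
def partialDeriv (a b : ℕ) (u : ℝ → ℝ → ℂ) (x t : ℝ) : ℂ :=
  iteratedDeriv b (fun s => iteratedDeriv a (fun y => u y s) x) t

/-- `(r, q)` solves the linearized classical Boussinesq system on the half-line with initial data
`r₀, q₀` and Dirichlet datum `g₀`, and is smooth on the closed quarter-plane. -/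
structure IsSmoothSolution (r₀ q₀ g₀ : ℝ → ℂ) (r q : ℝ → ℝ → ℂ) : Prop where
  smooth_r : ContDiffOn ℝ ∞ (fun p : ℝ × ℝ => r p.1 p.2) (Ici 0 ×ˢ Ici 0)
  smooth_q : ContDiffOn ℝ ∞ (fun p : ℝ × ℝ => q p.1 p.2) (Ici 0 ×ˢ Ici 0)
  eq_r : ∀ x t : ℝ, 0 < x → 0 < t →
    partialDeriv 0 1 r x t + partialDeriv 1 0 q x t = 0
  eq_q : ∀ x t : ℝ, 0 < x → 0 < t →
    partialDeriv 0 1 q x t + partialDeriv 1 0 r x t - partialDeriv 2 1 q x t = 0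
  init_r : ∀ x : ℝ, 0 ≤ x → r x 0 = r₀ x
  init_q : ∀ x : ℝ, 0 ≤ x → q x 0 = q₀ x
  bdry_q : ∀ t : ℝ, 0 ≤ t → q 0 t = g₀ t

/-- Decay as `x → ∞`, locally uniformly in `t`: the derivatives `∂ₓᵃ ∂ₜᵇ u` with `a ≤ 3`, `b ≤ 1`
are `O((1 + x)⁻²)`. Every function that is of Schwartz class in `x` (locally uniformly in `t`,
together with its first time derivative) has this property. -/
def DecaysAtInfinity (u : ℝ → ℝ → ℂ) : Prop :=
  ∀ a b : ℕ, a ≤ 3 → b ≤ 1 → ∀ T : ℝ, 0 < T → ∃ M : ℝ, ∀ x t : ℝ, 0 < x → 0 < t → t ≤ T →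
    ‖partialDeriv a b u x t‖ ≤ M / (1 + x) ^ 2

/-- The half-line Fourier transform `f̂(k) = ∫₀^∞ e^{-ikx} f(x) dx`. -/
def halfFourier (f : ℝ → ℂ) (k : ℂ) : ℂ :=
  ∫ x in Ioi (0 : ℝ), exp (-I * k * x) * f x

/-- The time transform `f̃(ω, t) = ∫₀^t e^{-iωτ} f(τ) dτ`. -/
def timeTransform (f : ℝ → ℂ) (w : ℂ) (t : ℝ) : ℂ :=
  ∫ τ in (0 : ℝ)..t, exp (-I * w * τ) * f τ

/-- The angle in `[0, 2π)` of `z`, measured counterclockwise from the direction `-i`. -/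
def angleFromBelow (z : ℂ) : ℝ := toIcoMod Real.two_pi_pos 0 (arg (I * z))

/-- The branch of `(1 + k²)^{1/2}` with cut `i[-1, 1]` and `μ(k) ∼ k` at infinity; on the cut the
formula gives the limit from the right. -/
def mu (k : ℂ) : ℂ :=
  (Real.sqrt ‖1 + k ^ 2‖ : ℂ) *
    exp (I * ((angleFromBelow (k + I) + angleFromBelow (k - I) - Real.pi : ℝ) : ℂ) / 2)

/-- The dispersion relation `ω(k) = k / μ(k)`. -/
def omega (k : ℂ) : ℂ := k / mu k

/-- `∫_γ F(k) dk` for a curve `γ` parametrized by `[0, 1]`. -/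
def contourIntegral (γ : ℝ → ℂ) (F : ℂ → ℂ) : ℂ :=
  ∫ s in (0 : ℝ)..1, F (γ s) * deriv γ s

/-- `γ` is a piecewise continuously differentiable closed curve of finite length in the open upper
half-plane that winds once, counterclockwise, around the point `i`. -/
structure IsContourAroundI (γ : ℝ → ℂ) : Prop where
  continuousOn : ContinuousOn γ (Icc 0 1)
  closed : γ 0 = γ 1
  piecewise : ∃ P : Set ℝ, P.Finite ∧ ContDiffOn ℝ 1 γ (Ioo 0 1 \ P)
  finiteLength : IntervalIntegrable (deriv γ) volume 0 1
  upper : ∀ s ∈ Icc (0 : ℝ) 1, 0 < (γ s).im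
  avoids : ∀ s ∈ Icc (0 : ℝ) 1, γ s ≠ I
  winding : contourIntegral γ (fun k => 1 / (k - I)) = 2 * Real.pi * I

/-- `∫_ℝ F(k) dk = L` as an improper integral, the two ends tending to infinity independently. -/
def HasImproperIntegral (F : ℝ → ℂ) (L : ℂ) : Prop :=
  (∀ a b : ℝ, IntervalIntegrable F volume a b) ∧
    Tendsto (fun p : ℝ × ℝ => ∫ k in p.1..p.2, F k) (atBot ×ˢ atTop) (𝓝 L)

/-- `∫_ℝ F(k) dk = L` in the sense of Abel: `L` is the limit of `∫_ℝ e^{-ε|k|} F(k) dk` as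
`ε → 0+`. -/
def HasAbelIntegral (F : ℝ → ℂ) (L : ℂ) : Prop :=
  (∀ ε : ℝ, 0 < ε → Integrable (fun k : ℝ => (Real.exp (-ε * |k|) : ℂ) * F k)) ∧
    Tendsto (fun ε : ℝ => ∫ k : ℝ, (Real.exp (-ε * |k|) : ℂ) * F k) (𝓝[>] 0) (𝓝 L)

/-- `e^{iωt} + e^{-iωt}` with `ω = ω(k)`. -/
def expSum (k : ℂ) (t : ℝ) : ℂ := exp (I * omega k * t) + exp (-I * omega k * t)

/-- `e^{iωt} - e^{-iωt}` with `ω = ω(k)`. -/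
def expDiff (k : ℂ) (t : ℝ) : ℂ := exp (I * omega k * t) - exp (-I * omega k * t)

/-- `e^{iωt} f̃(ω, t) + e^{-iωt} f̃(-ω, t)` with `ω = ω(k)`. -/
def transSum (f : ℝ → ℂ) (k : ℂ) (t : ℝ) : ℂ :=
  exp (I * omega k * t) * timeTransform f (omega k) t +
    exp (-I * omega k * t) * timeTransform f (-omega k) t

/-- `e^{iωt} f̃(ω, t) - e^{-iωt} f̃(-ω, t)` with `ω = ω(k)`. -/
def transDiff (f : ℝ → ℂ) (k : ℂ) (t : ℝ) : ℂ :=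
  exp (I * omega k * t) * timeTransform f (omega k) t -
    exp (-I * omega k * t) * timeTransform f (-omega k) t

end LinearBoussinesq

end

/-!
The half-line Fourier transform in `x` turns the system, for `Im k ≤ 0`, into a linear system of
ordinary differential equations in `t` with frequency `ω(k)`, whose Duhamel formula expresses
`r̂(k, t)` and `q̂(k, t)` through the initial data and the boundary values `q`, `q_t` and
`h = r - q_{xt}` at `x = 0`; the last one is unknown. The square root `μ(k)` enters the boundary
terms only through entire functions of `ω² = k² / (1 + k²)`, so these terms are holomorphic off
`±i`, and their inverse Fourier integral over `ℝ` can be deformed to the contour `γ` around `i`: the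
coordinate `ζ = log ((k - i) / (k + i))` turns `γ` into a path from a point to its translate by
`2πi`. Their limit `q₀(0) sin t` as `k → ∞` has to be subtracted first; its inverse transform is a
multiple of `∫ e^{ikx} dk`, which vanishes for `x ≠ 0` in the sense of Abel only.

The unknown `h` is eliminated by evaluating the same formulas at `-k` for `k` in the upper
half-plane: there `r̂(-k, t)` and `q̂(-k, t)` are holomorphic, so their integrals over `γ` vanish,
and the coefficient of `h` is odd in `k` for `r` and even for `q`.
-/

noncomputable section

namespace LinearBoussinesq

/-- The open upper half-plane without `i`, in which the contours of the theorem live. -/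
def puncturedHalfPlane : Set ℂ := {k | 0 < k.im} \ {I}

/-- The closed upper half-plane without `i`; contour integrals are moved to its boundary `ℝ`. -/
def closedPuncturedHalfPlane : Set ℂ := {k | 0 ≤ k.im} \ {I}

theorem puncturedHalfPlane_subset_closed : puncturedHalfPlane ⊆ closedPuncturedHalfPlane :=
  sdiff_subset_sdiff_left fun k (hk : 0 < k.im) => hk.le

theorem isOpen_puncturedHalfPlane : IsOpen puncturedHalfPlane :=
  (isOpen_lt continuous_const continuous_im).sdiff isClosed_singleton

theorem ofReal_mem_closedPuncturedHalfPlane (k : ℝ) : (k : ℂ) ∈ closedPuncturedHalfPlane :=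
  ⟨(ofReal_im k).ge, fun h => by simpa using congrArg im h⟩

theorem add_I_ne_zero {k : ℂ} (hk : 0 ≤ k.im) : k + I ≠ 0 := fun h => by
  have him : k.im + 1 = 0 := by simpa using congrArg im h
  linarith

theorem one_add_sq_eq (k : ℂ) : 1 + k ^ 2 = (k - I) * (k + I) := by
  linear_combination I_sq

theorem one_add_sq_ne_zero {k : ℂ} (hk : k ∈ closedPuncturedHalfPlane) : 1 + k ^ 2 ≠ 0 := by
  rw [one_add_sq_eq]
  exact mul_ne_zero (sub_ne_zero.2 hk.2) (add_I_ne_zero hk.1)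

theorem continuousOn_two_I_div :
    ContinuousOn (fun k : ℂ => 2 * I / (1 + k ^ 2)) puncturedHalfPlane :=
  continuousOn_const.div (by fun_prop) fun _ hk =>
    one_add_sq_ne_zero (puncturedHalfPlane_subset_closed hk)

theorem norm_sub_I_lt_norm_add_I_iff {k : ℂ} : ‖k - I‖ < ‖k + I‖ ↔ 0 < k.im := by
  rw [← sq_lt_sq₀ (norm_nonneg _) (norm_nonneg _), Complex.sq_norm, Complex.sq_norm,
    normSq_apply, normSq_apply]
  simp only [sub_re, sub_im, add_re, add_im, I_re, I_im]
  constructor <;> intro h <;> nlinarith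

theorem norm_sub_I_le_norm_add_I_iff {k : ℂ} : ‖k - I‖ ≤ ‖k + I‖ ↔ 0 ≤ k.im := by
  rw [← sq_le_sq₀ (norm_nonneg _) (norm_nonneg _), Complex.sq_norm, Complex.sq_norm,
    normSq_apply, normSq_apply]
  simp only [sub_re, sub_im, add_re, add_im, I_re, I_im]
  constructor <;> intro h <;> nlinarith

theorem contourIntegral_const_mul (γ : ℝ → ℂ) (c : ℂ) (F : ℂ → ℂ) :
    contourIntegral γ (fun k => c * F k) = c * contourIntegral γ F := by
  simp only [contourIntegral, mul_assoc, intervalIntegral.integral_const_mul]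

theorem hasDerivAt_integral_of_continuousOn_sdiff {l : ℝ → ℂ} {a b s : ℝ} {P : Set ℝ}
    (hP : P.Finite) (hl : IntervalIntegrable l volume a b)
    (hlc : ContinuousOn l (Ioo a b \ P)) (hs : s ∈ Ioo a b \ P) :
    HasDerivAt (fun s => ∫ u in a..s, l u) (l s) s := by
  have hopen : IsOpen (Ioo a b \ P) := isOpen_Ioo.sdiff hP.isClosed
  refine intervalIntegral.integral_hasDerivAt_right (hl.mono_set ?_)
    (hlc.stronglyMeasurableAtFilter hopen s hs) (hlc.continuousAt (hopen.mem_nhds hs))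
  exact uIcc_subset_uIcc_left (Icc_subset_uIcc ⟨hs.1.1.le, hs.1.2.le⟩)

theorem continuousOn_integral_right {l : ℝ → ℂ} {a b : ℝ} (hab : a ≤ b)
    (hl : IntervalIntegrable l volume a b) :
    ContinuousOn (fun s => ∫ u in a..s, l u) (Icc a b) := by
  rw [← uIcc_of_le hab]
  exact intervalIntegral.continuousOn_primitive_interval' hl left_mem_uIcc

theorem eq_mul_exp_integral {w l : ℝ → ℂ} {a b : ℝ} {P : Set ℝ} (hab : a ≤ b) (hP : P.Finite)
    (hw : ContinuousOn w (Icc a b)) (hl : IntervalIntegrable l volume a b)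
    (hlc : ContinuousOn l (Ioo a b \ P))
    (hd : ∀ s ∈ Ioo a b \ P, HasDerivAt w (l s * w s) s) :
    w b = w a * exp (∫ u in a..b, l u) := by
  have hconst := integral_eq_of_hasDerivAt_off_countable_of_le
    (fun s => w s * exp (-∫ u in a..s, l u)) (fun _ => 0) hab hP.countable
    (hw.mul (continuousOn_integral_right hab hl).neg.cexp)
    (fun s hs => by
      refine ((hd s hs).mul
        (hasDerivAt_integral_of_continuousOn_sdiff hP hl hlc hs).neg.cexp).congr_deriv ?_
      ring) intervalIntegrable_const
  rw [intervalIntegral.integral_zero, intervalIntegral.integral_same, neg_zero, exp_zero, mul_one,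
    exp_neg, eq_comm, sub_eq_zero] at hconst
  rw [← hconst, inv_mul_cancel_right₀ (exp_ne_zero _)]

theorem exists_log_lift {w l : ℝ → ℂ} {a b : ℝ} {P : Set ℝ} (hab : a ≤ b) (hP : P.Finite)
    (hw : ContinuousOn w (Icc a b)) (hwa : w a ≠ 0) (hl : IntervalIntegrable l volume a b)
    (hlc : ContinuousOn l (Ioo a b \ P))
    (hd : ∀ s ∈ Ioo a b \ P, HasDerivAt w (l s * w s) s) :
    ∃ ζ : ℝ → ℂ, ContinuousOn ζ (Icc a b) ∧ (∀ s ∈ Ioo a b \ P, HasDerivAt ζ (l s) s) ∧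
      (∀ s ∈ Icc a b, exp (ζ s) = w s) ∧ ζ b = ζ a + ∫ u in a..b, l u := by
  refine ⟨fun s => log (w a) + ∫ u in a..s, l u,
    continuousOn_const.add (continuousOn_integral_right hab hl),
    fun s hs => (hasDerivAt_integral_of_continuousOn_sdiff hP hl hlc hs).const_add _,
    fun s hs => ?_, by simp⟩
  have hsub : Ioo a s \ P ⊆ Ioo a b \ P :=
    sdiff_subset_sdiff_left (Ioo_subset_Ioo_right hs.2)
  rw [exp_add, exp_log hwa]
  exact (eq_mul_exp_integral hs.1 hP (hw.mono (Icc_subset_Icc_right hs.2))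
    (hl.mono_set (uIcc_subset_uIcc_left (Icc_subset_uIcc hs))) (hlc.mono hsub)
    fun u hu => hd u (hsub hu)).symm

namespace IsContourAroundI

variable {γ : ℝ → ℂ}

theorem mem_puncturedHalfPlane (hγ : IsContourAroundI γ) {s : ℝ} (hs : s ∈ Icc (0 : ℝ) 1) :
    γ s ∈ puncturedHalfPlane :=
  ⟨hγ.upper s hs, hγ.avoids s hs⟩

theorem continuousOn_comp (hγ : IsContourAroundI γ) {F : ℂ → ℂ}
    (hF : ContinuousOn F puncturedHalfPlane) : ContinuousOn (fun s => F (γ s)) (Icc 0 1) :=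
  hF.comp hγ.continuousOn fun _ hs => hγ.mem_puncturedHalfPlane hs

theorem intervalIntegrable_comp (hγ : IsContourAroundI γ) {F : ℂ → ℂ}
    (hF : ContinuousOn F puncturedHalfPlane) :
    IntervalIntegrable (fun s => F (γ s) * deriv γ s) volume 0 1 :=
  hγ.finiteLength.continuousOn_mul (by
    rw [uIcc_of_le zero_le_one]
    exact hγ.continuousOn_comp hF)

theorem contourIntegral_congr (hγ : IsContourAroundI γ) {F G : ℂ → ℂ}
    (h : EqOn F G puncturedHalfPlane) : contourIntegral γ F = contourIntegral γ G := by
  refine intervalIntegral.integral_congr fun s hs => ?_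
  rw [uIcc_of_le zero_le_one] at hs
  simp only [h (hγ.mem_puncturedHalfPlane hs)]

theorem contourIntegral_add (hγ : IsContourAroundI γ) {F G : ℂ → ℂ}
    (hF : ContinuousOn F puncturedHalfPlane) (hG : ContinuousOn G puncturedHalfPlane) :
    contourIntegral γ (fun k => F k + G k) = contourIntegral γ F + contourIntegral γ G := by
  simp only [contourIntegral, add_mul]
  exact intervalIntegral.integral_add (hγ.intervalIntegrable_comp hF)
    (hγ.intervalIntegrable_comp hG)

theorem exists_finite_hasDerivAt (hγ : IsContourAroundI γ) :
    ∃ P : Set ℝ, P.Finite ∧ ContinuousOn (deriv γ) (Ioo 0 1 \ P) ∧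
      ∀ s ∈ Ioo (0 : ℝ) 1 \ P, HasDerivAt γ (deriv γ s) s := by
  obtain ⟨P, hP, hγP⟩ := hγ.piecewise
  have hopen : IsOpen (Ioo (0 : ℝ) 1 \ P) := isOpen_Ioo.sdiff hP.isClosed
  exact ⟨P, hP, hγP.continuousOn_deriv_of_isOpen hopen le_rfl, fun s hs =>
    ((hγP.differentiableOn one_ne_zero).differentiableAt (hopen.mem_nhds hs)).hasDerivAt⟩

theorem contourIntegral_eq_sub (hγ : IsContourAroundI γ) {F : ℂ → ℂ} {G : ℝ → ℂ} {P : Set ℝ}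
    (hP : P.Finite) (hF : ContinuousOn F puncturedHalfPlane) (hG : ContinuousOn G (Icc 0 1))
    (hd : ∀ s ∈ Ioo (0 : ℝ) 1 \ P, HasDerivAt G (F (γ s) * deriv γ s) s) :
    contourIntegral γ F = G 1 - G 0 :=
  integral_eq_of_hasDerivAt_off_countable_of_le G _ zero_le_one hP.countable hG hd
    (hγ.intervalIntegrable_comp hF)

theorem contourIntegral_eq_zero_of_differentiableOn (hγ : IsContourAroundI γ) {F : ℂ → ℂ}
    (hF : DifferentiableOn ℂ F {k | 0 < k.im}) : contourIntegral γ F = 0 := by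
  obtain ⟨P, hP, -, hγd⟩ := hγ.exists_finite_hasDerivAt
  obtain ⟨H, hH⟩ := (convex_halfSpace_im_gt 0).exists_forall_hasDerivWithinAt hF
  have hHd : ∀ s ∈ Icc (0 : ℝ) 1, HasDerivAt H (F (γ s)) (γ s) := fun s hs =>
    (hH _ (hγ.upper s hs)).hasDerivAt
      ((isOpen_lt continuous_const continuous_im).mem_nhds (hγ.upper s hs))
  rw [hγ.contourIntegral_eq_sub (G := fun s => H (γ s)) hP (hF.continuousOn.mono sdiff_subset)
    (fun s hs => (hHd s hs).continuousAt.comp_continuousWithinAt (hγ.continuousOn s hs))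
    fun s hs => (hHd s (Ioo_subset_Icc_self hs.1)).comp s (hγd s hs), hγ.closed, sub_self]

theorem contourIntegral_div_sub_I (hγ : IsContourAroundI γ) {F : ℂ → ℂ}
    (hF : DifferentiableOn ℂ F {k | 0 < k.im}) :
    contourIntegral γ (fun k => F k / (k - I)) = 2 * Real.pi * I * F I := by
  have hslope : DifferentiableOn ℂ (dslope F I) {k | 0 < k.im} :=
    (differentiableOn_dslope
      ((isOpen_lt continuous_const continuous_im).mem_nhds (by simp))).2 hF
  have hsplit : EqOn (fun k => F k / (k - I)) (fun k => dslope F I k + F I * (1 / (k - I)))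
      puncturedHalfPlane := fun k hk => by
    simp only [dslope_of_ne F hk.2, slope_def_field, sub_div, mul_one_div, sub_add_cancel]
  have hpole : ContinuousOn (fun k : ℂ => F I * (1 / (k - I))) puncturedHalfPlane :=
    continuousOn_const.mul (continuousOn_const.div (by fun_prop) fun k hk => sub_ne_zero.2 hk.2)
  rw [hγ.contourIntegral_congr hsplit,
    hγ.contourIntegral_add (hslope.continuousOn.mono sdiff_subset) hpole,
    hγ.contourIntegral_eq_zero_of_differentiableOn hslope, contourIntegral_const_mul, hγ.winding,
    zero_add, mul_comm]

theorem contourIntegral_two_I_div (hγ : IsContourAroundI γ) :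
    contourIntegral γ (fun k => 2 * I / (1 + k ^ 2)) = 2 * Real.pi * I := by
  have hdiff : DifferentiableOn ℂ (fun k : ℂ => 2 * I / (k + I)) {k | 0 < k.im} :=
    (differentiableOn_const _).div (by fun_prop) fun k hk => add_I_ne_zero (le_of_lt hk)
  have h := hγ.contourIntegral_div_sub_I hdiff
  rw [← two_mul, div_self (mul_ne_zero two_ne_zero I_ne_zero), mul_one] at h
  simpa only [div_div, one_add_sq_eq, mul_comm (_ - I)] using h

theorem exists_cayley_log_lift (hγ : IsContourAroundI γ) :
    ∃ (ζ : ℝ → ℂ) (P : Set ℝ), P.Finite ∧ ContinuousOn ζ (Icc 0 1) ∧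
      (∀ s ∈ Ioo (0 : ℝ) 1 \ P, HasDerivAt ζ (2 * I / (1 + γ s ^ 2) * deriv γ s) s) ∧
      (∀ s ∈ Icc (0 : ℝ) 1, exp (ζ s) = (γ s - I) / (γ s + I)) ∧
      ζ 1 = ζ 0 + 2 * Real.pi * I := by
  obtain ⟨P, hP, hγ', hγd⟩ := hγ.exists_finite_hasDerivAt
  have hp : ∀ s ∈ Icc (0 : ℝ) 1, γ s + I ≠ 0 := fun s hs => add_I_ne_zero (hγ.upper s hs).le
  have hl := continuousOn_two_I_div
  obtain ⟨ζ, hζc, hζd, hexp, hinc⟩ := exists_log_lift (w := fun s => (γ s - I) / (γ s + I))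
    zero_le_one hP
    ((hγ.continuousOn.sub continuousOn_const).div (hγ.continuousOn.add continuousOn_const) hp)
    (div_ne_zero (sub_ne_zero.2 (hγ.avoids 0 (by simp))) (hp 0 (by simp)))
    (hγ.intervalIntegrable_comp hl)
    (((hγ.continuousOn_comp hl).mono fun s hs => Ioo_subset_Icc_self hs.1).mul hγ')
    (fun s hs => by
      have hs' := Ioo_subset_Icc_self hs.1
      have hm : γ s - I ≠ 0 := sub_ne_zero.2 (hγ.avoids s hs')
      have hps := hp s hs'
      refine (((hγd s hs).sub_const I).div ((hγd s hs).add_const I) hps).congr_deriv ?_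
      rw [one_add_sq_eq]
      field_simp
      ring)
  exact ⟨ζ, P, hP, hζc, hζd, hexp, hinc.trans (congrArg _ hγ.contourIntegral_two_I_div)⟩

end IsContourAroundI

/-- The inverse of `k ↦ log ((k - i) / (k + i))`: a `2πi`-periodic parametrization of the upper
half-plane without `i` by the left half-plane. -/
def cayleyExp (ζ : ℂ) : ℂ := I * (1 + exp ζ) / (1 - exp ζ)

theorem cayleyExp_add_two_pi_I (ζ : ℂ) : cayleyExp (ζ + 2 * Real.pi * I) = cayleyExp ζ := by
  rw [cayleyExp, cayleyExp, exp_periodic ζ]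

theorem cayleyExp_of_exp_eq {ζ k : ℂ} (hk : k + I ≠ 0) (h : exp ζ = (k - I) / (k + I)) :
    cayleyExp ζ = k := by
  have hsub : 1 - exp ζ = 2 * I / (k + I) := by
    rw [h]
    field_simp
    ring
  have hadd : 1 + exp ζ = 2 * k / (k + I) := by
    rw [h]
    field_simp
    ring
  rw [cayleyExp, hsub, hadd]
  field_simp

section CayleyExp

variable {ζ : ℂ}

theorem differentiableAt_cayleyExp (h : exp ζ ≠ 1) : DifferentiableAt ℂ cayleyExp ζ := by
  have hsub : 1 - exp ζ ≠ 0 := sub_ne_zero.2 h.symm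
  unfold cayleyExp
  fun_prop (disch := assumption)

theorem cayleyExp_sub_I (h : exp ζ ≠ 1) : cayleyExp ζ - I = exp ζ * (cayleyExp ζ + I) := by
  have hsub : 1 - exp ζ ≠ 0 := sub_ne_zero.2 h.symm
  unfold cayleyExp
  field_simp
  ring

theorem norm_cayleyExp_sub_I (h : exp ζ ≠ 1) :
    ‖cayleyExp ζ - I‖ = Real.exp ζ.re * ‖cayleyExp ζ + I‖ := by
  rw [cayleyExp_sub_I h, norm_mul, norm_exp]

theorem cayleyExp_ne_I (h : exp ζ ≠ 1) : cayleyExp ζ ≠ I := fun hI => by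
  have hprod := cayleyExp_sub_I h
  rw [hI, sub_self, eq_comm, ← two_mul] at hprod
  exact mul_ne_zero (exp_ne_zero ζ) (mul_ne_zero two_ne_zero I_ne_zero) hprod

theorem cayleyExp_mem_closedPuncturedHalfPlane (h : exp ζ ≠ 1) (hre : ζ.re ≤ 0) :
    cayleyExp ζ ∈ closedPuncturedHalfPlane := by
  refine ⟨norm_sub_I_le_norm_add_I_iff.1 ?_, cayleyExp_ne_I h⟩
  rw [norm_cayleyExp_sub_I h]
  exact mul_le_of_le_one_left (norm_nonneg _) (Real.exp_le_one_iff.2 hre)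

theorem exp_ne_one_of_re_neg (hre : ζ.re < 0) : exp ζ ≠ 1 := fun h => by
  have hlt := Real.exp_lt_one_iff.2 hre
  rw [← norm_exp, h, norm_one] at hlt
  exact lt_irrefl _ hlt

theorem cayleyExp_mem_puncturedHalfPlane (hre : ζ.re < 0) :
    cayleyExp ζ ∈ puncturedHalfPlane := by
  have h := exp_ne_one_of_re_neg hre
  have hadd : 0 < ‖cayleyExp ζ + I‖ :=
    norm_pos_iff.2 (add_I_ne_zero (cayleyExp_mem_closedPuncturedHalfPlane h hre.le).1)
  refine ⟨norm_sub_I_lt_norm_add_I_iff.1 ?_, cayleyExp_ne_I h⟩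
  rw [norm_cayleyExp_sub_I h]
  exact mul_lt_of_lt_one_left hadd (Real.exp_lt_one_iff.2 hre)

theorem re_neg_of_exp_eq {k : ℂ} (hk : 0 < k.im) (h : exp ζ = (k - I) / (k + I)) : ζ.re < 0 := by
  rw [← Real.exp_lt_one_iff, ← norm_exp, h, norm_div,
    div_lt_one (norm_pos_iff.2 (add_I_ne_zero hk.le))]
  exact norm_sub_I_lt_norm_add_I_iff.2 hk

end CayleyExp

theorem sub_eq_sub_of_periodic {U : Set ℂ} (hU : IsOpen U) (hUc : IsPreconnected U)
    {H Ψ : ℂ → ℂ} {c : ℂ} (hadd : ∀ z ∈ U, z + c ∈ U) (hH : ∀ z ∈ U, HasDerivAt H (Ψ z) z)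
    (hΨ : ∀ z, Ψ (z + c) = Ψ z) {z w : ℂ} (hz : z ∈ U) (hw : w ∈ U) :
    H (z + c) - H z = H (w + c) - H w := by
  have hd : ∀ z ∈ U, HasDerivAt (fun z => H (z + c) - H z) 0 z := fun z hz =>
    (((hH _ (hadd z hz)).comp_add_const z c).sub (hH _ hz)).congr_deriv
      (by rw [hΨ, sub_self])
  exact hU.is_const_of_deriv_eq_zero hUc
    (fun z hz => (hd z hz).differentiableAt.differentiableWithinAt)
    (fun z hz => (hd z hz).deriv) hz hw

section DeformationToRealLine

variable {Φ : ℂ → ℂ}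

theorem continuous_comp_cayleyExp_vertical (hΦ : DifferentiableOn ℂ Φ puncturedHalfPlane)
    {δ : ℝ} (hδ : 0 < δ) : Continuous fun θ : ℝ => Φ (cayleyExp (-δ + θ * I)) := by
  refine continuous_iff_continuousAt.2 fun θ => ?_
  have hre : (-(δ : ℂ) + θ * I).re < 0 := by simpa using hδ
  exact ContinuousAt.comp (f := fun θ : ℝ => cayleyExp (-δ + θ * I))
    (hΦ.continuousOn.continuousAt
      (isOpen_puncturedHalfPlane.mem_nhds (cayleyExp_mem_puncturedHalfPlane hre)))
    (ContinuousAt.comp (f := fun θ : ℝ => -(δ : ℂ) + θ * I)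
      (differentiableAt_cayleyExp (exp_ne_one_of_re_neg hre)).continuousAt (by fun_prop))

/-- In the coordinate `ζ = log ((k - i) / (k + i))` the form `Φ(k) dk / (1 + k²)` becomes
`-(i/2) Φ(k(ζ)) dζ`. -/
theorem exists_hasDerivAt_comp_cayleyExp (hΦ : DifferentiableOn ℂ Φ puncturedHalfPlane) :
    ∃ H : ℂ → ℂ, ∀ ζ : ℂ, ζ.re < 0 → HasDerivAt H (-(I / 2) * Φ (cayleyExp ζ)) ζ := by
  have hΨ : DifferentiableOn ℂ (fun ζ => -(I / 2) * Φ (cayleyExp ζ)) {ζ | ζ.re < 0} :=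
    fun ζ hζ => ((DifferentiableAt.comp ζ (hΦ.differentiableAt
      (isOpen_puncturedHalfPlane.mem_nhds (cayleyExp_mem_puncturedHalfPlane hζ)))
      (differentiableAt_cayleyExp (exp_ne_one_of_re_neg hζ))).const_mul
        _).differentiableWithinAt
  obtain ⟨H, hH⟩ := (convex_halfSpace_re_lt 0).exists_forall_hasDerivWithinAt hΨ
  exact ⟨H, fun ζ hζ =>
    (hH ζ hζ).hasDerivAt ((isOpen_lt continuous_re continuous_const).mem_nhds hζ)⟩

theorem integral_comp_cayleyExp_vertical (hΦ : DifferentiableOn ℂ Φ puncturedHalfPlane)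
    {H : ℂ → ℂ} (hH : ∀ ζ : ℂ, ζ.re < 0 → HasDerivAt H (-(I / 2) * Φ (cayleyExp ζ)) ζ)
    {δ : ℝ} (hδ : 0 < δ) :
    ∫ θ in (0 : ℝ)..2 * Real.pi, 1 / 2 * Φ (cayleyExp (-δ + θ * I)) =
      H (-δ + 2 * Real.pi * I) - H (-δ) := by
  have hd : ∀ θ : ℝ, HasDerivAt (fun θ : ℝ => H (-δ + θ * I))
      (1 / 2 * Φ (cayleyExp (-δ + θ * I))) θ := fun θ => by
    have hline : HasDerivAt (fun θ : ℝ => -(δ : ℂ) + θ * I) I θ := by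
      simpa using ((hasDerivAt_id θ).ofReal_comp.mul_const I).const_add (-(δ : ℂ))
    refine ((hH _ (by simpa using hδ)).comp θ hline).congr_deriv ?_
    linear_combination (-1 / 2 * Φ (cayleyExp (-δ + θ * I))) * I_sq
  rw [intervalIntegral.integral_eq_sub_of_hasDerivAt (fun θ _ => hd θ)
    ((continuous_const.mul (continuous_comp_cayleyExp_vertical hΦ hδ)).intervalIntegrable _ _)]
  push_cast
  simp only [zero_mul, add_zero]

/-- The form has period `2πi` in the coordinate `ζ`, so its integral over one period does not
depend on the starting point and the contour may be replaced by a vertical segment. -/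
theorem IsContourAroundI.contourIntegral_eq_integral_vertical {γ : ℝ → ℂ}
    (hγ : IsContourAroundI γ) (hΦ : DifferentiableOn ℂ Φ puncturedHalfPlane) {δ : ℝ}
    (hδ : 0 < δ) :
    contourIntegral γ (fun k => Φ k / (1 + k ^ 2)) =
      ∫ θ in (0 : ℝ)..2 * Real.pi, 1 / 2 * Φ (cayleyExp (-δ + θ * I)) := by
  obtain ⟨ζ, P, hP, hζc, hζd, hexp, hper⟩ := hγ.exists_cayley_log_lift
  obtain ⟨H, hH⟩ := exists_hasDerivAt_comp_cayleyExp hΦ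
  have hζre : ∀ s ∈ Icc (0 : ℝ) 1, (ζ s).re < 0 := fun s hs =>
    re_neg_of_exp_eq (hγ.upper s hs) (hexp s hs)
  have hcurve : contourIntegral γ (fun k => Φ k / (1 + k ^ 2)) = H (ζ 1) - H (ζ 0) := by
    refine hγ.contourIntegral_eq_sub (G := fun s => H (ζ s)) hP
      (hΦ.continuousOn.div (by fun_prop) fun k hk =>
        one_add_sq_ne_zero (puncturedHalfPlane_subset_closed hk))
      (fun s hs => (hH _ (hζre s hs)).continuousAt.comp_continuousWithinAt (hζc s hs))
      fun s hs => ((hH _ (hζre s (Ioo_subset_Icc_self hs.1))).comp s (hζd s hs)).congr_deriv ?_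
    have hs' := Ioo_subset_Icc_self hs.1
    rw [cayleyExp_of_exp_eq (add_I_ne_zero (hγ.upper s hs').le) (hexp s hs')]
    linear_combination (-Φ (γ s) / (1 + γ s ^ 2) * deriv γ s) * I_sq
  have hperiod := sub_eq_sub_of_periodic (isOpen_lt continuous_re continuous_const)
    (convex_halfSpace_re_lt 0).isPreconnected (c := 2 * Real.pi * I)
    (fun z (hz : z.re < 0) => show (z + 2 * Real.pi * I).re < 0 by simpa using hz) hH
    (fun z => by rw [cayleyExp_add_two_pi_I]) (hζre 0 (by simp))
    (show (-(δ : ℂ)).re < 0 by simpa using hδ)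
  rw [hcurve, hper, hperiod, integral_comp_cayleyExp_vertical hΦ hH hδ]

theorem exp_pi_add_two_arctan_mul_I (k : ℝ) :
    exp (((Real.pi + 2 * Real.arctan k : ℝ) : ℂ) * I) = ((k : ℂ) - I) / (k + I) := by
  have hpos : (0 : ℝ) < 1 + k ^ 2 := by positivity
  have hsqrt : ((Real.sqrt (1 + k ^ 2) : ℝ) : ℂ) ≠ 0 := by
    exact_mod_cast (Real.sqrt_pos.2 hpos).ne'
  have hsq : ((Real.sqrt (1 + k ^ 2) : ℝ) : ℂ) ^ 2 = (k - I) * (k + I) := by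
    rw [← one_add_sq_eq, ← ofReal_pow, Real.sq_sqrt hpos.le]
    push_cast
    ring
  have harctan : exp ((Real.arctan k : ℂ) * I) = (1 + I * k) / (Real.sqrt (1 + k ^ 2) : ℝ) := by
    rw [exp_mul_I, ← ofReal_cos, ← ofReal_sin, Real.cos_arctan, Real.sin_arctan]
    push_cast
    field_simp
  have hadd : (k + I : ℂ) ≠ 0 := add_I_ne_zero (ofReal_im k).ge
  have hsub : (k - I : ℂ) ≠ 0 := sub_ne_zero.2 (ofReal_mem_closedPuncturedHalfPlane k).2
  have hsplit : (((Real.pi + 2 * Real.arctan k : ℝ) : ℂ) * I) =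
      Real.pi * I + ((Real.arctan k : ℂ) * I + (Real.arctan k : ℂ) * I) := by
    push_cast
    ring
  rw [hsplit, exp_add, exp_add, harctan, exp_pi_mul_I, div_mul_div_comm,
    ← sq (Real.sqrt _ : ℂ), hsq]
  field_simp
  linear_combination (-1 - (k : ℂ) ^ 2) * I_sq

theorem cayleyExp_pi_add_two_arctan_mul_I (k : ℝ) :
    cayleyExp (((Real.pi + 2 * Real.arctan k : ℝ) : ℂ) * I) = k :=
  cayleyExp_of_exp_eq (add_I_ne_zero (ofReal_im k).ge) (exp_pi_add_two_arctan_mul_I k)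

theorem range_pi_add_two_arctan :
    range (fun k => Real.pi + 2 * Real.arctan k) = Ioo 0 (2 * Real.pi) := by
  ext θ
  constructor
  · rintro ⟨k, rfl⟩
    constructor <;> linarith [Real.arctan_lt_pi_div_two k, Real.neg_pi_div_two_lt_arctan k]
  · rintro ⟨hpos, hlt⟩
    refine ⟨Real.tan ((θ - Real.pi) / 2), ?_⟩
    simp only
    rw [Real.arctan_tan (by linarith) (by linarith)]
    ring

theorem exp_mul_I_ne_one {θ : ℝ} (hθ : θ ∈ Ioo 0 (2 * Real.pi)) : exp (θ * I) ≠ 1 := by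
  rw [ne_eq, exp_eq_one_iff]
  rintro ⟨n, hn⟩
  have hθn : θ = n * (2 * Real.pi) := by
    have hI : (θ : ℂ) * I = (n * (2 * Real.pi) : ℝ) * I := by
      rw [hn]
      push_cast
      ring
    exact_mod_cast mul_right_cancel₀ I_ne_zero hI
  rw [hθn] at hθ
  have hn0 : (0 : ℝ) < n := pos_of_mul_pos_left hθ.1 Real.two_pi_pos.le
  have hn1 : (n : ℝ) < 1 := lt_of_mul_lt_mul_right (by simpa using hθ.2) Real.two_pi_pos.le
  norm_cast at hn0 hn1
  lia

theorem integral_cayleyExp_circle (Φ : ℂ → ℂ) :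
    ∫ θ in (0 : ℝ)..2 * Real.pi, 1 / 2 * Φ (cayleyExp (θ * I)) =
      ∫ k : ℝ, Φ k / (1 + (k : ℂ) ^ 2) := by
  rw [intervalIntegral.integral_of_le Real.two_pi_pos.le, integral_Ioc_eq_integral_Ioo,
    ← range_pi_add_two_arctan, ← image_univ, integral_image_eq_integral_abs_deriv_smul
      (f' := fun k => 2 * (1 / (1 + k ^ 2))) MeasurableSet.univ
      (fun k _ => (((Real.hasDerivAt_arctan k).const_mul 2).const_add _).hasDerivWithinAt)
      (fun a _ b _ h => Real.arctan_injective (by simpa using h)), setIntegral_univ]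
  refine integral_congr_ae (Eventually.of_forall fun k => ?_)
  simp only
  rw [cayleyExp_pi_add_two_arctan_mul_I, abs_of_pos (by positivity), real_smul]
  push_cast
  ring

theorem norm_comp_cayleyExp_le {M : ℝ}
    (hM : ∀ k : ℂ, 0 ≤ k.im → ‖k + I‖ ≤ 3 * ‖k - I‖ → ‖Φ k‖ ≤ M) {ζ : ℂ} (hre : ζ.re < 0)
    (hre' : -1 < ζ.re) : ‖Φ (cayleyExp ζ)‖ ≤ M := by
  have h := exp_ne_one_of_re_neg hre
  refine hM _ (cayleyExp_mem_closedPuncturedHalfPlane h hre.le).1 ?_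
  have hthird : 1 ≤ 3 * Real.exp ζ.re := by
    rw [← neg_neg ζ.re, Real.exp_neg, ← div_eq_mul_inv, one_le_div (Real.exp_pos _)]
    exact (Real.exp_le_exp.2 (by linarith)).trans Real.exp_one_lt_three.le
  rw [norm_cayleyExp_sub_I h, ← mul_assoc]
  exact le_mul_of_one_le_left (norm_nonneg _) hthird

theorem tendsto_comp_cayleyExp_vertical (hΦ : ContinuousOn Φ closedPuncturedHalfPlane) {θ : ℝ}
    (hθ : θ ∈ Ioo 0 (2 * Real.pi)) :
    Tendsto (fun δ : ℝ => Φ (cayleyExp (-δ + θ * I))) (𝓝[>] 0) (𝓝 (Φ (cayleyExp (θ * I)))) := by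
  have h := exp_mul_I_ne_one hθ
  have hvert : Tendsto (fun δ : ℝ => -(δ : ℂ) + θ * I) (𝓝[>] 0) (𝓝 (θ * I)) := by
    have hcont : Continuous fun δ : ℝ => -(δ : ℂ) + θ * I := by fun_prop
    simpa using (hcont.tendsto 0).mono_left nhdsWithin_le_nhds
  refine (hΦ _ (cayleyExp_mem_closedPuncturedHalfPlane h (by simp))).tendsto.comp
    (tendsto_nhdsWithin_iff.2
      ⟨(differentiableAt_cayleyExp h).continuousAt.tendsto.comp hvert, ?_⟩)
  filter_upwards [self_mem_nhdsWithin] with δ hδ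
  exact puncturedHalfPlane_subset_closed
    (cayleyExp_mem_puncturedHalfPlane (by simpa using hδ))

/-- The bound is required outside a disc around `i`, on the region swept by the circles
`|k - i| = e^{-δ} |k + i|`, `0 < δ < 1`, that shrink to the real line as `δ → 0`. -/
theorem IsContourAroundI.contourIntegral_eq_integral {γ : ℝ → ℂ} (hγ : IsContourAroundI γ)
    (hΦ : DifferentiableOn ℂ Φ puncturedHalfPlane) (hΦc : ContinuousOn Φ closedPuncturedHalfPlane)
    {M : ℝ} (hM : ∀ k : ℂ, 0 ≤ k.im → ‖k + I‖ ≤ 3 * ‖k - I‖ → ‖Φ k‖ ≤ M) :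
    contourIntegral γ (fun k => Φ k / (1 + k ^ 2)) = ∫ k : ℝ, Φ k / (1 + (k : ℂ) ^ 2) := by
  rw [← integral_cayleyExp_circle]
  have hlim : Tendsto (fun δ : ℝ => ∫ θ in (0 : ℝ)..2 * Real.pi,
      1 / 2 * Φ (cayleyExp (-δ + θ * I))) (𝓝[>] 0)
      (𝓝 (∫ θ in (0 : ℝ)..2 * Real.pi, 1 / 2 * Φ (cayleyExp (θ * I)))) := by
    refine intervalIntegral.tendsto_integral_filter_of_dominated_convergence
      (fun _ => 1 / 2 * M) ?_ ?_ (by simp) ?_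
    · filter_upwards [self_mem_nhdsWithin] with δ hδ
      exact (continuous_const.mul
        (continuous_comp_cayleyExp_vertical hΦ hδ)).aestronglyMeasurable
    · filter_upwards [Ioo_mem_nhdsGT one_pos] with δ hδ
      refine Eventually.of_forall fun θ _ => ?_
      have hbound : ‖Φ (cayleyExp (-δ + θ * I))‖ ≤ M :=
        norm_comp_cayleyExp_le hM (by simpa using hδ.1) (by simpa using hδ.2)
      rw [norm_mul, norm_div, norm_one, RCLike.norm_ofNat]
      gcongr
    · filter_upwards [compl_mem_ae_iff.2 (measure_singleton (2 * Real.pi))] with θ hθ hmem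
      rw [uIoc_of_le Real.two_pi_pos.le] at hmem
      exact (tendsto_comp_cayleyExp_vertical hΦc
        ⟨hmem.1, lt_of_le_of_ne hmem.2 hθ⟩).const_mul _
  refine tendsto_nhds_unique (tendsto_const_nhds.congr' ?_) hlim
  filter_upwards [self_mem_nhdsWithin] with δ hδ
  exact hγ.contourIntegral_eq_integral_vertical hΦ hδ

end DeformationToRealLine

theorem integrable_div_one_add_sq {Φ : ℝ → ℂ} (hΦ : Continuous Φ) {M : ℝ}
    (hM : ∀ k, ‖Φ k‖ ≤ M) : Integrable fun k : ℝ => Φ k / (1 + (k : ℂ) ^ 2) := by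
  refine ((integrable_inv_one_add_sq.ofReal (𝕜 := ℂ)).bdd_mul hΦ.aestronglyMeasurable
    (Eventually.of_forall hM)).congr (Eventually.of_forall fun k => ?_)
  simp [div_eq_mul_inv]

theorem hasImproperIntegral_of_integrable {F : ℝ → ℂ} (hF : Integrable F) :
    HasImproperIntegral F (∫ k, F k) :=
  ⟨fun _ _ => hF.intervalIntegrable,
    intervalIntegral_tendsto_integral hF tendsto_fst tendsto_snd⟩

section Linearity

variable {F G : ℝ → ℂ} {L M : ℂ}

theorem HasImproperIntegral.add (hF : HasImproperIntegral F L) (hG : HasImproperIntegral G M) :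
    HasImproperIntegral (fun k => F k + G k) (L + M) := by
  refine ⟨fun a b => (hF.1 a b).add (hG.1 a b), (hF.2.add hG.2).congr fun p => ?_⟩
  rw [intervalIntegral.integral_add (hF.1 _ _) (hG.1 _ _)]

theorem HasImproperIntegral.const_mul (hF : HasImproperIntegral F L) (c : ℂ) :
    HasImproperIntegral (fun k => c * F k) (c * L) := by
  refine ⟨fun a b => (hF.1 a b).const_mul c, (hF.2.const_mul c).congr fun p => ?_⟩
  rw [intervalIntegral.integral_const_mul]

theorem HasImproperIntegral.sub (hF : HasImproperIntegral F L) (hG : HasImproperIntegral G M) :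
    HasImproperIntegral (fun k => F k - G k) (L - M) := by
  simpa only [neg_one_mul, ← sub_eq_add_neg] using hF.add (hG.const_mul (-1))

theorem HasAbelIntegral.add (hF : HasAbelIntegral F L) (hG : HasAbelIntegral G M) :
    HasAbelIntegral (fun k => F k + G k) (L + M) := by
  refine ⟨fun ε hε => ?_, (hF.2.add hG.2).congr' ?_⟩
  · simp only [mul_add]
    exact (hF.1 ε hε).add (hG.1 ε hε)
  · filter_upwards [self_mem_nhdsWithin] with ε hε
    simp only [mul_add]
    rw [integral_add (hF.1 ε hε) (hG.1 ε hε)]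

theorem HasAbelIntegral.const_mul (hF : HasAbelIntegral F L) (c : ℂ) :
    HasAbelIntegral (fun k => c * F k) (c * L) := by
  refine ⟨fun ε hε => ?_, (hF.2.const_mul c).congr fun ε => ?_⟩
  · simpa only [mul_left_comm] using (hF.1 ε hε).const_mul c
  · simp only [mul_left_comm _ c, integral_const_mul]

theorem HasAbelIntegral.sub (hF : HasAbelIntegral F L) (hG : HasAbelIntegral G M) :
    HasAbelIntegral (fun k => F k - G k) (L - M) := by
  simpa only [neg_one_mul, ← sub_eq_add_neg] using hF.add (hG.const_mul (-1))

end Linearity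

theorem integrableOn_Ioi_exp_mul_of_bounded {f : ℝ → ℂ} (hf : Continuous f) {M : ℝ}
    (hM : ∀ k, 0 < k → ‖f k‖ ≤ M) {ε : ℝ} (hε : 0 < ε) :
    IntegrableOn (fun k => (Real.exp (-ε * k) : ℂ) * f k) (Ioi 0) :=
  (exp_neg_integrableOn_Ioi 0 hε).ofReal.mul_bdd hf.aestronglyMeasurable
    ((ae_restrict_iff' measurableSet_Ioi).2 (Eventually.of_forall hM))

theorem integrable_exp_neg_abs {ε : ℝ} (hε : 0 < ε) :
    Integrable fun k : ℝ => Real.exp (-ε * |k|) := by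
  rw [← integrableOn_univ, ← Iic_union_Ioi (a := (0 : ℝ))]
  refine IntegrableOn.union
    ((integrableOn_exp_mul_Iic hε 0).congr_fun (fun k hk => ?_) measurableSet_Iic)
    ((exp_neg_integrableOn_Ioi 0 hε).congr_fun (fun k hk => ?_) measurableSet_Ioi)
  · simp only [abs_of_nonpos (show k ≤ 0 from hk), neg_mul_neg]
  · simp only [abs_of_pos (show 0 < k from hk)]

theorem integrable_exp_neg_abs_mul {F : ℝ → ℂ} (hF : Continuous F) {M : ℝ} (hM : ∀ k, ‖F k‖ ≤ M)
    {ε : ℝ} (hε : 0 < ε) : Integrable fun k : ℝ => (Real.exp (-ε * |k|) : ℂ) * F k :=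
  (integrable_exp_neg_abs hε).ofReal.mul_bdd hF.aestronglyMeasurable (Eventually.of_forall hM)

theorem integral_exp_neg_abs_mul {F : ℝ → ℂ} {ε : ℝ}
    (hF : Integrable fun k : ℝ => (Real.exp (-ε * |k|) : ℂ) * F k) :
    ∫ k : ℝ, (Real.exp (-ε * |k|) : ℂ) * F k =
      ∫ k in Ioi (0 : ℝ), (Real.exp (-ε * k) : ℂ) * (F k + F (-k)) := by
  have hneg := integral_comp_neg_Ioi 0 fun k : ℝ => (Real.exp (-ε * |k|) : ℂ) * F k
  rw [neg_zero] at hneg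
  rw [← intervalIntegral.integral_Iic_add_Ioi hF.integrableOn hF.integrableOn, ← hneg, add_comm,
    ← integral_add hF.integrableOn hF.comp_neg.integrableOn]
  refine setIntegral_congr_fun measurableSet_Ioi fun k hk => ?_
  simp only [abs_neg, abs_of_pos (show 0 < k from hk), mul_add]

theorem exists_norm_le_of_tendsto_atTop {E : Type*} [NormedAddCommGroup E] {Ψ : ℝ → E} {L : E}
    (hΨ : Continuous Ψ) (hL : Tendsto Ψ atTop (𝓝 L)) : ∃ C, ∀ k, 0 < k → ‖Ψ k‖ ≤ C := by
  obtain ⟨N, hN⟩ := eventually_atTop.1 (hL.norm.eventually_le_const (lt_add_one ‖L‖))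
  obtain ⟨C, hC⟩ := (isCompact_Icc (a := (0 : ℝ)) (b := N)).exists_bound_of_continuousOn
    hΨ.continuousOn
  refine ⟨max C (‖L‖ + 1), fun k hk => ?_⟩
  rcases le_total k N with hkN | hNk
  · exact (hC k ⟨hk.le, hkN⟩).trans (le_max_left _ _)
  · exact (hN k hNk).trans (le_max_right _ _)

theorem hasDerivAt_integral_neg_self {F : ℝ → ℂ} (hF : Continuous F) (k : ℝ) :
    HasDerivAt (fun k => ∫ u in -k..k, F u) (F k + F (-k)) k := by
  have hprim : ∀ k, HasDerivAt (fun k => ∫ u in (0 : ℝ)..k, F u) (F k) k := fun k =>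
    hF.integral_hasStrictDerivAt 0 k |>.hasDerivAt
  have hneg : HasDerivAt (fun k : ℝ => ∫ u in (0 : ℝ)..-k, F u) (-F (-k)) k := by
    simpa only [Function.comp_def, neg_one_smul] using (hprim (-k)).scomp k (hasDerivAt_neg k)
  rw [← sub_neg_eq_add]
  refine ((hprim k).sub hneg).congr_of_eventuallyEq (Eventually.of_forall fun k => ?_)
  exact (intervalIntegral.integral_interval_sub_left (hF.intervalIntegrable _ _)
    (hF.intervalIntegrable _ _)).symm

theorem integral_Ioi_exp_mul_deriv {Ψ ψ : ℝ → ℂ} (hd : ∀ k, HasDerivAt Ψ (ψ k) k)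
    (hψ : Continuous ψ) (hzero : Ψ 0 = 0) {L : ℂ} (hL : Tendsto Ψ atTop (𝓝 L)) {M : ℝ}
    (hM : ∀ k, 0 < k → ‖ψ k‖ ≤ M) {ε : ℝ} (hε : 0 < ε) :
    ∫ k in Ioi (0 : ℝ), (Real.exp (-ε * k) : ℂ) * ψ k =
      ε * ∫ k in Ioi (0 : ℝ), (Real.exp (-ε * k) : ℂ) * Ψ k := by
  have hΨ : Continuous Ψ := continuous_iff_continuousAt.2 fun k => (hd k).continuousAt
  obtain ⟨C, hC⟩ := exists_norm_le_of_tendsto_atTop hΨ hL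
  have hiψ := integrableOn_Ioi_exp_mul_of_bounded hψ hM hε
  have hiΨ := (integrableOn_Ioi_exp_mul_of_bounded hΨ hC hε).const_mul (ε : ℂ)
  have hprod : ∀ k, HasDerivAt (fun k : ℝ => (Real.exp (-ε * k) : ℂ) * Ψ k)
      ((Real.exp (-ε * k) : ℂ) * ψ k - ε * ((Real.exp (-ε * k) : ℂ) * Ψ k)) k := fun k => by
    refine ((((hasDerivAt_id k).const_mul (-ε)).exp.ofReal_comp).mul (hd k)).congr_deriv ?_
    simp only [id]
    push_cast
    ring
  have hexp : Tendsto (fun k : ℝ => (Real.exp (-ε * k) : ℂ)) atTop (𝓝 ((0 : ℝ) : ℂ)) :=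
    (continuous_ofReal.tendsto 0).comp
      (Real.tendsto_exp_atBot.comp (tendsto_id.const_mul_atTop_of_neg (neg_neg_of_pos hε)))
  have hint := integral_Ioi_of_hasDerivAt_of_tendsto' (fun k _ => hprod k) (hiψ.sub hiΨ)
    (hexp.mul hL)
  rwa [integral_sub hiψ hiΨ, integral_const_mul, hzero, ofReal_zero, zero_mul, mul_zero,
    sub_zero, sub_eq_zero] at hint

/-- After the substitution `u = εk` the limit can be taken under the integral sign. -/
theorem tendsto_mul_integral_Ioi_exp_mul {Ψ : ℝ → ℂ} {L : ℂ} (hΨ : Continuous Ψ)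
    (hL : Tendsto Ψ atTop (𝓝 L)) :
    Tendsto (fun ε : ℝ => ε * ∫ k in Ioi (0 : ℝ), (Real.exp (-ε * k) : ℂ) * Ψ k) (𝓝[>] 0)
      (𝓝 L) := by
  obtain ⟨C, hC⟩ := exists_norm_le_of_tendsto_atTop hΨ hL
  have hexp : IntegrableOn (fun u : ℝ => Real.exp (-u)) (Ioi 0) := by
    simpa only [neg_mul, one_mul] using exp_neg_integrableOn_Ioi 0 one_pos
  have hlim : Tendsto (fun ε : ℝ => ∫ u in Ioi (0 : ℝ), (Real.exp (-u) : ℂ) * Ψ (ε⁻¹ * u))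
      (𝓝[>] 0) (𝓝 (∫ u in Ioi (0 : ℝ), (Real.exp (-u) : ℂ) * L)) := by
    refine tendsto_integral_filter_of_dominated_convergence (fun u => Real.exp (-u) * C)
      (Eventually.of_forall fun ε => Continuous.aestronglyMeasurable (by fun_prop)) ?_
      (hexp.mul_const C) ?_
    · filter_upwards [self_mem_nhdsWithin] with ε hε
      refine (ae_restrict_iff' measurableSet_Ioi).2 (Eventually.of_forall fun u hu => ?_)
      rw [norm_mul, norm_real, Real.norm_eq_abs, Real.abs_exp]
      gcongr
      exact hC _ (mul_pos (inv_pos.2 hε) hu)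
    · exact (ae_restrict_iff' measurableSet_Ioi).2 (Eventually.of_forall fun u hu =>
        (hL.comp (tendsto_inv_nhdsGT_zero.atTop_mul_const hu)).const_mul _)
  rw [integral_mul_const, integral_complex_ofReal, integral_exp_neg_Ioi_zero, ofReal_one,
    one_mul] at hlim
  refine hlim.congr' ?_
  filter_upwards [self_mem_nhdsWithin] with ε (hε : 0 < ε)
  have hsubst := integral_comp_mul_left_Ioi (fun u : ℝ => (Real.exp (-u) : ℂ) * Ψ (ε⁻¹ * u)) 0 hε
  simp only [mul_zero, inv_mul_cancel_left₀ hε.ne', ← neg_mul] at hsubst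
  rw [hsubst, real_smul, ofReal_inv, mul_inv_cancel_left₀ (ofReal_ne_zero.2 hε.ne')]

theorem HasImproperIntegral.hasAbelIntegral {F : ℝ → ℂ} {L : ℂ} (h : HasImproperIntegral F L)
    (hF : Continuous F) {M : ℝ} (hM : ∀ k, ‖F k‖ ≤ M) : HasAbelIntegral F L := by
  have hint : ∀ ε : ℝ, 0 < ε → Integrable fun k : ℝ => (Real.exp (-ε * |k|) : ℂ) * F k :=
    fun ε hε => integrable_exp_neg_abs_mul hF hM hε
  have hL : Tendsto (fun k => ∫ u in -k..k, F u) atTop (𝓝 L) :=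
    h.2.comp (tendsto_neg_atTop_atBot.prodMk tendsto_id)
  have hd := hasDerivAt_integral_neg_self hF
  refine ⟨hint, (tendsto_mul_integral_Ioi_exp_mul
    (continuous_iff_continuousAt.2 fun k => (hd k).continuousAt) hL).congr' ?_⟩
  filter_upwards [self_mem_nhdsWithin] with ε hε
  rw [integral_exp_neg_abs_mul (hint ε hε)]
  exact (integral_Ioi_exp_mul_deriv hd (by fun_prop) (by simp) hL
    (fun k _ => norm_add_le_of_le (hM k) (hM (-k))) hε).symm

theorem norm_exp_I_mul_ofReal_mul (k x : ℝ) : ‖exp (I * k * x)‖ = 1 := by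
  rw [mul_assoc, mul_comm, ← ofReal_mul, norm_exp_ofReal_mul_I]

theorem integral_exp_neg_abs_mul_exp {ε : ℝ} (hε : 0 < ε) (x : ℝ) :
    ∫ k : ℝ, (Real.exp (-ε * |k|) : ℂ) * exp (I * k * x) =
      -1 / (-ε + I * x) + -1 / (-ε - I * x) := by
  have hadd : (-(ε : ℂ) + I * x).re < 0 := by simp [hε]
  have hsub : (-(ε : ℂ) - I * x).re < 0 := by simp [hε]
  have hIadd := integral_exp_mul_complex_Ioi hadd 0
  have hIsub := integral_exp_mul_complex_Ioi hsub 0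
  simp only [ofReal_zero, mul_zero, exp_zero] at hIadd hIsub
  rw [integral_exp_neg_abs_mul (integrable_exp_neg_abs_mul (by fun_prop)
      (fun k => (norm_exp_I_mul_ofReal_mul k x).le) hε),
    ← hIadd, ← hIsub, ← integral_add (integrableOn_exp_mul_complex_Ioi hadd 0)
      (integrableOn_exp_mul_complex_Ioi hsub 0)]
  refine integral_congr_ae (Eventually.of_forall fun k => ?_)
  simp only
  rw [ofReal_exp, mul_add, ← exp_add, ← exp_add]
  congr 2 <;> · push_cast; ring

theorem hasAbelIntegral_exp {x : ℝ} (hx : x ≠ 0) :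
    HasAbelIntegral (fun k : ℝ => exp (I * k * x)) 0 := by
  refine ⟨fun ε hε => integrable_exp_neg_abs_mul (by fun_prop)
    (fun k => (norm_exp_I_mul_ofReal_mul k x).le) hε, ?_⟩
  have hcont : ContinuousAt
      (fun ε : ℝ => -1 / (-(ε : ℂ) + I * x) + -1 / (-(ε : ℂ) - I * x)) 0 :=
    .add (.div (by fun_prop) (by fun_prop) (by simpa using hx))
      (.div (by fun_prop) (by fun_prop) (by simpa using hx))
  have hlim := hcont.tendsto.mono_left (nhdsWithin_le_nhds (s := Ioi 0))
  simp only [ofReal_zero, neg_zero, zero_add, zero_sub, div_neg, add_neg_cancel] at hlim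
  refine hlim.congr' ?_
  filter_upwards [self_mem_nhdsWithin] with ε hε
  exact (integral_exp_neg_abs_mul_exp hε x).symm

/-- `F` can be integrated over the real line instead of over the contour `γ`. -/
structure DeformsToRealLine (γ : ℝ → ℂ) (F : ℂ → ℂ) : Prop where
  continuousOn : ContinuousOn F puncturedHalfPlane
  hasImproperIntegral : HasImproperIntegral (fun k : ℝ => F k) (contourIntegral γ F)

namespace DeformsToRealLine

variable {γ : ℝ → ℂ} {F G : ℂ → ℂ}

theorem congr (hF : DeformsToRealLine γ F) (hγ : IsContourAroundI γ)
    (h : EqOn F G closedPuncturedHalfPlane) : DeformsToRealLine γ G := by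
  have h' := h.mono puncturedHalfPlane_subset_closed
  refine ⟨hF.continuousOn.congr h'.symm, ?_⟩
  rw [← hγ.contourIntegral_congr h',
    ← funext fun k : ℝ => h (ofReal_mem_closedPuncturedHalfPlane k)]
  exact hF.hasImproperIntegral

theorem add (hF : DeformsToRealLine γ F) (hG : DeformsToRealLine γ G)
    (hγ : IsContourAroundI γ) : DeformsToRealLine γ fun k => F k + G k := by
  refine ⟨hF.continuousOn.add hG.continuousOn, ?_⟩
  rw [hγ.contourIntegral_add hF.continuousOn hG.continuousOn]
  exact hF.hasImproperIntegral.add hG.hasImproperIntegral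

theorem const_mul (hF : DeformsToRealLine γ F) (c : ℂ) :
    DeformsToRealLine γ fun k => c * F k := by
  refine ⟨continuousOn_const.mul hF.continuousOn, ?_⟩
  rw [contourIntegral_const_mul]
  exact hF.hasImproperIntegral.const_mul c

theorem of_hasDerivAt (hγ : IsContourAroundI γ)
    (hG : ∀ k ∈ closedPuncturedHalfPlane, HasDerivAt G (F k) k)
    (hF : ContinuousOn F closedPuncturedHalfPlane) {L : ℂ}
    (hL : Tendsto (fun k : ℝ => G k) (cocompact ℝ) (𝓝 L)) : DeformsToRealLine γ F := by
  have hF' := hF.mono puncturedHalfPlane_subset_closed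
  have hFℝ : Continuous fun k : ℝ => F k :=
    hF.comp_continuous continuous_ofReal ofReal_mem_closedPuncturedHalfPlane
  have hGγ : ∀ s ∈ Icc (0 : ℝ) 1, HasDerivAt G (F (γ s)) (γ s) := fun s hs =>
    hG _ (puncturedHalfPlane_subset_closed (hγ.mem_puncturedHalfPlane hs))
  have hcontour : contourIntegral γ F = 0 := by
    obtain ⟨P, hP, -, hγd⟩ := hγ.exists_finite_hasDerivAt
    rw [hγ.contourIntegral_eq_sub (G := fun s => G (γ s)) hP hF'
      (fun s hs => (hGγ s hs).continuousAt.comp_continuousWithinAt (hγ.continuousOn s hs))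
      fun s hs => (hGγ s (Ioo_subset_Icc_self hs.1)).comp s (hγd s hs), hγ.closed, sub_self]
  refine ⟨hF', fun a b => hFℝ.intervalIntegrable a b, ?_⟩
  have hlim := ((hL.mono_left atTop_le_cocompact).comp tendsto_snd).sub
    ((hL.mono_left atBot_le_cocompact).comp (tendsto_fst (f := atBot) (g := atTop)))
  rw [sub_self] at hlim
  rw [hcontour]
  refine hlim.congr fun p => (intervalIntegral.integral_eq_sub_of_hasDerivAt
    (f := fun k : ℝ => G k) (fun k _ => ?_) (hFℝ.intervalIntegrable _ _)).symm
  exact (hG k (ofReal_mem_closedPuncturedHalfPlane k)).comp_ofReal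

end DeformsToRealLine

/-- `Φ` is holomorphic on the closed upper half-plane without `i` and bounded there outside the
disc `‖k + i‖ > 3 ‖k - i‖` around `i`. -/
structure IsBoundedSymbol (Φ : ℂ → ℂ) : Prop where
  differentiableAt : ∀ k ∈ closedPuncturedHalfPlane, DifferentiableAt ℂ Φ k
  exists_bound : ∃ M, ∀ k : ℂ, 0 ≤ k.im → ‖k + I‖ ≤ 3 * ‖k - I‖ → ‖Φ k‖ ≤ M

theorem norm_ofReal_add_I (k : ℝ) : ‖(k : ℂ) + I‖ = ‖(k : ℂ) - I‖ := by
  rw [← norm_conj, map_add, conj_ofReal, conj_I, sub_eq_add_neg]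

namespace IsBoundedSymbol

variable {Φ Ψ : ℂ → ℂ}

theorem continuousOn (hΦ : IsBoundedSymbol Φ) : ContinuousOn Φ closedPuncturedHalfPlane :=
  fun k hk => (hΦ.differentiableAt k hk).continuousAt.continuousWithinAt

theorem continuous_ofReal (hΦ : IsBoundedSymbol Φ) : Continuous fun k : ℝ => Φ k :=
  hΦ.continuousOn.comp_continuous Complex.continuous_ofReal ofReal_mem_closedPuncturedHalfPlane

theorem exists_bound_ofReal (hΦ : IsBoundedSymbol Φ) : ∃ M, ∀ k : ℝ, ‖Φ k‖ ≤ M := by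
  obtain ⟨M, hM⟩ := hΦ.exists_bound
  refine ⟨M, fun k => hM k (ofReal_im k).ge ?_⟩
  rw [norm_ofReal_add_I]
  linarith [norm_nonneg ((k : ℂ) - I)]

theorem const (c : ℂ) : IsBoundedSymbol fun _ => c :=
  ⟨fun _ _ => differentiableAt_const c, ‖c‖, fun _ _ _ => le_rfl⟩

theorem add (hΦ : IsBoundedSymbol Φ) (hΨ : IsBoundedSymbol Ψ) :
    IsBoundedSymbol fun k => Φ k + Ψ k := by
  obtain ⟨M, hM⟩ := hΦ.exists_bound
  obtain ⟨N, hN⟩ := hΨ.exists_bound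
  exact ⟨fun k hk => (hΦ.differentiableAt k hk).add (hΨ.differentiableAt k hk), M + N,
    fun k hk hI => norm_add_le_of_le (hM k hk hI) (hN k hk hI)⟩

theorem sub (hΦ : IsBoundedSymbol Φ) (hΨ : IsBoundedSymbol Ψ) :
    IsBoundedSymbol fun k => Φ k - Ψ k := by
  obtain ⟨M, hM⟩ := hΦ.exists_bound
  obtain ⟨N, hN⟩ := hΨ.exists_bound
  exact ⟨fun k hk => (hΦ.differentiableAt k hk).sub (hΨ.differentiableAt k hk), M + N,
    fun k hk hI => norm_sub_le_of_le (hM k hk hI) (hN k hk hI)⟩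

theorem mul (hΦ : IsBoundedSymbol Φ) (hΨ : IsBoundedSymbol Ψ) :
    IsBoundedSymbol fun k => Φ k * Ψ k := by
  obtain ⟨M, hM⟩ := hΦ.exists_bound
  obtain ⟨N, hN⟩ := hΨ.exists_bound
  exact ⟨fun k hk => (hΦ.differentiableAt k hk).mul (hΨ.differentiableAt k hk), M * N,
    fun k hk hI => norm_mul_le_of_le (hM k hk hI) (hN k hk hI)⟩

theorem comp_differentiable {A : ℂ → ℂ} (hA : Differentiable ℂ A) (hΦ : IsBoundedSymbol Φ) :
    IsBoundedSymbol fun k => A (Φ k) := by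
  obtain ⟨M, hM⟩ := hΦ.exists_bound
  obtain ⟨N, hN⟩ := (isCompact_closedBall (0 : ℂ) M).exists_bound_of_continuousOn
    hA.continuous.continuousOn
  exact ⟨fun k hk => (hA _).comp k (hΦ.differentiableAt k hk), N,
    fun k hk hI => hN _ (mem_closedBall_zero_iff.2 (hM k hk hI))⟩

theorem exp_I_mul {x : ℝ} (hx : 0 ≤ x) : IsBoundedSymbol fun k => exp (I * k * x) := by
  refine ⟨fun k _ => by fun_prop, 1, fun k hk _ => ?_⟩
  rw [norm_exp, Real.exp_le_one_iff, mul_assoc, I_mul_re, im_mul_ofReal, neg_nonpos]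
  exact mul_nonneg hk hx

theorem one_le_norm_add_I {k : ℂ} (hk : 0 ≤ k.im) : 1 ≤ ‖k + I‖ := by
  have him := (le_abs_self _).trans (abs_im_le_norm (k + I))
  rw [add_im, I_im] at him
  linarith

theorem norm_add_I_sq_le {k : ℂ} (hI : ‖k + I‖ ≤ 3 * ‖k - I‖) :
    ‖k + I‖ ^ 2 ≤ 3 * ‖1 + k ^ 2‖ := by
  rw [one_add_sq_eq, norm_mul, sq, ← mul_assoc]
  gcongr

theorem inv_one_add_sq : IsBoundedSymbol fun k => (1 + k ^ 2)⁻¹ := by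
  refine ⟨fun k hk => ?_, 3, fun k hk hI => ?_⟩
  · have hne := one_add_sq_ne_zero hk
    fun_prop (disch := assumption)
  · have hone := one_le_norm_add_I hk
    have hsq := norm_add_I_sq_le hI
    rw [norm_inv]
    exact inv_le_of_inv_le₀ (by norm_num) (by nlinarith)

theorem I_mul_div_one_add_sq : IsBoundedSymbol fun k => I * k / (1 + k ^ 2) := by
  refine ⟨fun k hk => ?_, 6, fun k hk hI => ?_⟩
  · have hne := one_add_sq_ne_zero hk
    fun_prop (disch := assumption)
  · have hone := one_le_norm_add_I hk
    have hsq := norm_add_I_sq_le hI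
    have hk' : ‖k‖ ≤ ‖k + I‖ + 1 := by simpa using norm_sub_le (k + I) I
    rw [norm_div, norm_mul, norm_I, one_mul, div_le_iff₀ (by nlinarith)]
    nlinarith

theorem integrable_div_one_add_sq (hΦ : IsBoundedSymbol Φ) :
    Integrable fun k : ℝ => Φ k / (1 + (k : ℂ) ^ 2) :=
  hΦ.exists_bound_ofReal.elim fun _ => LinearBoussinesq.integrable_div_one_add_sq
    hΦ.continuous_ofReal

theorem deformsToRealLine_div_one_add_sq (hΦ : IsBoundedSymbol Φ) {γ : ℝ → ℂ}
    (hγ : IsContourAroundI γ) : DeformsToRealLine γ fun k => Φ k / (1 + k ^ 2) := by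
  obtain ⟨M, hM⟩ := hΦ.exists_bound
  refine ⟨(hΦ.continuousOn.mono puncturedHalfPlane_subset_closed).div (by fun_prop) fun k hk =>
    one_add_sq_ne_zero (puncturedHalfPlane_subset_closed hk), ?_⟩
  rw [hγ.contourIntegral_eq_integral (fun k hk => (hΦ.differentiableAt k
    (puncturedHalfPlane_subset_closed hk)).differentiableWithinAt) hΦ.continuousOn hM]
  exact hasImproperIntegral_of_integrable hΦ.integrable_div_one_add_sq

end IsBoundedSymbol

theorem hasDerivAt_exp_mul_div_one_add_sq (x : ℝ) {k : ℂ} (hk : 1 + k ^ 2 ≠ 0) :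
    HasDerivAt (fun k => exp (I * k * x) * (k / (1 + k ^ 2)))
      (x * (exp (I * k * x) * (I * k / (1 + k ^ 2))) +
        exp (I * k * x) * (2 * (1 + k ^ 2)⁻¹ - 1) / (1 + k ^ 2)) k := by
  have hexp : HasDerivAt (fun k : ℂ => I * k * x) (I * x) k := by
    simpa using ((hasDerivAt_id k).const_mul I).mul_const (x : ℂ)
  have hsq : HasDerivAt (fun k : ℂ => 1 + k ^ 2) (2 * k) k := by
    simpa using (hasDerivAt_pow 2 k).const_add 1
  refine (hexp.cexp.mul ((hasDerivAt_id k).div hsq hk)).congr_deriv ?_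
  simp only [Pi.div_apply, id]
  field_simp
  ring

theorem tendsto_exp_mul_div_one_add_sq (x : ℝ) :
    Tendsto (fun k : ℝ => exp (I * k * x) * (k / (1 + (k : ℂ) ^ 2))) (cocompact ℝ) (𝓝 0) := by
  refine squeeze_zero_norm (fun k => ?_)
    (tendsto_inv_atTop_zero.comp tendsto_norm_cocompact_atTop)
  have hsq : (1 : ℂ) + k ^ 2 = (1 + k ^ 2 : ℝ) := by
    push_cast
    ring
  rw [norm_mul, norm_exp_I_mul_ofReal_mul, one_mul, norm_div, hsq, norm_real, norm_real,
    Real.norm_of_nonneg (by positivity : 0 ≤ 1 + k ^ 2), Function.comp_apply,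
    div_le_iff₀ (by positivity)]
  rcases eq_or_ne k 0 with rfl | hk
  · simp
  · rw [← Real.norm_of_nonneg (sq_nonneg k), norm_pow, mul_add, sq,
      inv_mul_cancel_left₀ (norm_ne_zero_iff.2 hk), mul_one]
    exact le_add_of_nonneg_left (by positivity)

theorem IsContourAroundI.deformsToRealLine_exp_mul_div {γ : ℝ → ℂ} (hγ : IsContourAroundI γ)
    {x : ℝ} (hx : 0 < x) :
    DeformsToRealLine γ fun k => exp (I * k * x) * (I * k / (1 + k ^ 2)) := by
  have hexp := IsBoundedSymbol.exp_I_mul hx.le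
  have hΦ : IsBoundedSymbol fun k => exp (I * k * x) * (2 * (1 + k ^ 2)⁻¹ - 1) :=
    hexp.mul (((IsBoundedSymbol.const 2).mul .inv_one_add_sq).sub (.const 1))
  have hderiv := DeformsToRealLine.of_hasDerivAt hγ
    (fun k hk => hasDerivAt_exp_mul_div_one_add_sq x (one_add_sq_ne_zero hk))
    ((continuousOn_const.mul (hexp.mul .I_mul_div_one_add_sq).continuousOn).add
      (hΦ.continuousOn.div (by fun_prop) fun k hk => one_add_sq_ne_zero hk))
    (tendsto_exp_mul_div_one_add_sq x)
  refine ((hderiv.add ((hΦ.deformsToRealLine_div_one_add_sq hγ).const_mul (-1)) hγ).const_mul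
    (x : ℂ)⁻¹).congr hγ fun k _ => ?_
  have hx' : (x : ℂ) ≠ 0 := ofReal_ne_zero.2 hx.ne'
  simp only
  rw [add_assoc, neg_one_mul, add_neg_cancel, add_zero, inv_mul_cancel_left₀ hx']

theorem exists_differentiable_eq_add_mul {A : ℂ → ℂ} (hA : Differentiable ℂ A) (a : ℂ) :
    ∃ A₁ : ℂ → ℂ, Differentiable ℂ A₁ ∧ ∀ z, A z = A a + (z - a) * A₁ z := by
  rw [← differentiableOn_univ] at hA
  refine ⟨dslope A a, differentiableOn_univ.1 ((differentiableOn_dslope univ_mem).2 hA),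
    fun z => ?_⟩
  rw [← smul_eq_mul, sub_smul_dslope, add_sub_cancel]

/-- The square `ω(k)² = k² / (1 + k²)` of the dispersion relation. -/
def omegaSq (k : ℂ) : ℂ := 1 - (1 + k ^ 2)⁻¹

theorem IsBoundedSymbol.comp_omegaSq {A : ℂ → ℂ} (hA : Differentiable ℂ A) :
    IsBoundedSymbol fun k => A (omegaSq k) :=
  .comp_differentiable hA ((const 1).sub inv_one_add_sq)

/-- The general form of the boundary terms, with `A`, `B`, `E` entire. -/
def boundaryForm (A B E : ℂ → ℂ) (k : ℂ) : ℂ :=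
  A (omegaSq k) - I * k / (1 + k ^ 2) * B (omegaSq k) + E (omegaSq k) * (1 + k ^ 2)⁻¹

section BoundaryForm

variable {A B E : ℂ → ℂ} (hA : Differentiable ℂ A) (hB : Differentiable ℂ B)
  (hE : Differentiable ℂ E)

include hA hB hE

theorem IsBoundedSymbol.boundaryForm : IsBoundedSymbol (boundaryForm A B E) :=
  ((comp_omegaSq hA).sub (I_mul_div_one_add_sq.mul (comp_omegaSq hB))).add
    ((comp_omegaSq hE).mul inv_one_add_sq)

/-- Subtracting the limit `A 1` at infinity leaves an integrable term and a multiple of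
`e^{ikx} k / (1 + k²)`. -/
theorem IsContourAroundI.deformsToRealLine_boundaryForm_sub {γ : ℝ → ℂ}
    (hγ : IsContourAroundI γ) {x : ℝ} (hx : 0 < x) :
    DeformsToRealLine γ fun k => exp (I * k * x) * (boundaryForm A B E k - A 1) := by
  obtain ⟨A₁, hA₁, hAeq⟩ := exists_differentiable_eq_add_mul hA 1
  obtain ⟨B₁, hB₁, hBeq⟩ := exists_differentiable_eq_add_mul hB 1
  have hΦ : IsBoundedSymbol fun k => exp (I * k * x) *
      (E (omegaSq k) - A₁ (omegaSq k) + I * k / (1 + k ^ 2) * B₁ (omegaSq k)) :=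
    (IsBoundedSymbol.exp_I_mul hx.le).mul (((IsBoundedSymbol.comp_omegaSq hE).sub
      (.comp_omegaSq hA₁)).add (.mul .I_mul_div_one_add_sq (.comp_omegaSq hB₁)))
  refine ((hΦ.deformsToRealLine_div_one_add_sq hγ).add
    ((hγ.deformsToRealLine_exp_mul_div hx).const_mul (-B 1)) hγ).congr hγ fun k _ => ?_
  have hω : omegaSq k - 1 = -(1 + k ^ 2)⁻¹ := by
    rw [omegaSq, sub_sub_cancel_left]
  simp only
  rw [boundaryForm, hAeq (omegaSq k), hBeq (omegaSq k), hω]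
  ring

theorem IsContourAroundI.hasImproperIntegral_boundaryForm_sub {γ : ℝ → ℂ}
    (hγ : IsContourAroundI γ) {x : ℝ} (hx : 0 < x) :
    HasImproperIntegral (fun k : ℝ => exp (I * k * x) * (boundaryForm A B E k - A 1))
      (contourIntegral γ fun k => exp (I * k * x) * boundaryForm A B E k) := by
  have h := hγ.deformsToRealLine_boundaryForm_sub hA hB hE hx
  have hentire : Differentiable ℂ fun k : ℂ => A 1 * exp (I * k * x) := by fun_prop
  convert h.hasImproperIntegral using 1
  rw [← add_zero (contourIntegral γ fun k => exp (I * k * x) * (_ - A 1)),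
    ← hγ.contourIntegral_eq_zero_of_differentiableOn hentire.differentiableOn,
    ← hγ.contourIntegral_add h.continuousOn hentire.continuous.continuousOn]
  congr 1 with k
  ring

end BoundaryForm

theorem exists_isContourAroundI : ∃ γ, IsContourAroundI γ := by
  have hcircle : ∀ s : ℝ, HasDerivAt (fun s : ℝ => I + 1 / 2 * exp (2 * Real.pi * I * s))
      (2 * Real.pi * I * (1 / 2 * exp (2 * Real.pi * I * s))) s := fun s => by
    have hlin : HasDerivAt (fun s : ℝ => 2 * Real.pi * I * (s : ℂ)) (2 * Real.pi * I) s := by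
      simpa using (ofRealCLM.hasDerivAt (x := s)).const_mul (2 * Real.pi * I)
    exact ((hlin.cexp.const_mul _).const_add I).congr_deriv (by ring)
  have hderiv := funext fun s => (hcircle s).deriv
  have hnorm : ∀ s : ℝ, ‖(1 / 2 : ℂ) * exp (2 * Real.pi * I * s)‖ = 1 / 2 := fun s => by
    rw [norm_mul, norm_exp]
    simp
  refine ⟨fun s => I + 1 / 2 * exp (2 * Real.pi * I * s), ?_, ?_, ⟨∅, finite_empty, ?_⟩, ?_,
    fun s _ => ?_, fun s _ => ?_, ?_⟩
  · fun_prop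
  · simp [exp_two_pi_mul_I]
  · exact (contDiff_const.add (contDiff_const.mul
      (contDiff_const.mul ofRealCLM.contDiff).cexp)).contDiffOn
  · rw [hderiv]
    exact Continuous.intervalIntegrable (by fun_prop) _ _
  · have him := (neg_le_abs _).trans ((abs_im_le_norm _).trans (hnorm s).le)
    rw [add_im, I_im]
    linarith
  · simp
  · have hone : ∀ s : ℝ, 1 / (I + 1 / 2 * exp (2 * Real.pi * I * s) - I) *
        (2 * Real.pi * I * (1 / 2 * exp (2 * Real.pi * I * s))) = 2 * Real.pi * I := fun s => by
      have hne := exp_ne_zero (2 * Real.pi * I * s)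
      rw [add_sub_cancel_left]
      field_simp
    simp only [contourIntegral, hderiv, hone, intervalIntegral.integral_const, sub_zero, one_smul]

/-- A continuous function on `(0, ∞)` that is `O((1 + x)⁻²)`. -/
structure HasQuadraticDecay (f : ℝ → ℂ) : Prop where
  continuousOn : ContinuousOn f (Ioi 0)
  exists_bound : ∃ M : ℝ, ∀ x : ℝ, 0 < x → ‖f x‖ ≤ M / (1 + x) ^ 2

theorem integrableOn_div_one_add_sq (M : ℝ) :
    IntegrableOn (fun x : ℝ => M / (1 + x) ^ 2) (Ioi 0) := by
  have hmeas : Measurable fun x : ℝ => M / (1 + x) ^ 2 := by fun_prop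
  refine (integrable_inv_one_add_sq.const_mul |M|).integrableOn.mono'
    hmeas.aestronglyMeasurable (ae_restrict_of_forall_mem measurableSet_Ioi fun x hx => ?_)
  have hx' : 0 < x := hx
  rw [norm_div, Real.norm_eq_abs, Real.norm_of_nonneg (by positivity), div_eq_mul_inv]
  exact mul_le_mul_of_nonneg_left (inv_anti₀ (by positivity) (by nlinarith)) (abs_nonneg _)

theorem norm_exp_neg_I_mul_mul_le {k : ℂ} (hk : k.im ≤ 0) {x : ℝ} (hx : 0 ≤ x) (z : ℂ) :
    ‖exp (-I * k * x) * z‖ ≤ ‖z‖ := by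
  rw [norm_mul]
  refine mul_le_of_le_one_left (norm_nonneg _) ?_
  rw [norm_exp, Real.exp_le_one_iff, re_mul_ofReal, neg_mul, neg_re, I_mul_re, neg_neg]
  exact mul_nonpos_of_nonpos_of_nonneg hk hx

namespace HasQuadraticDecay

variable {f g : ℝ → ℂ}

theorem integrableOn (hf : HasQuadraticDecay f) : IntegrableOn f (Ioi 0) := by
  obtain ⟨M, hM⟩ := hf.exists_bound
  exact (integrableOn_div_one_add_sq M).mono'
    (hf.continuousOn.aestronglyMeasurable measurableSet_Ioi)
    (ae_restrict_of_forall_mem measurableSet_Ioi hM)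

theorem add (hf : HasQuadraticDecay f) (hg : HasQuadraticDecay g) :
    HasQuadraticDecay fun x => f x + g x := by
  obtain ⟨M, hM⟩ := hf.exists_bound
  obtain ⟨N, hN⟩ := hg.exists_bound
  refine ⟨hf.continuousOn.add hg.continuousOn, M + N, fun x hx => ?_⟩
  rw [add_div]
  exact norm_add_le_of_le (hM x hx) (hN x hx)

theorem const_mul (hf : HasQuadraticDecay f) (c : ℂ) : HasQuadraticDecay fun x => c * f x := by
  obtain ⟨M, hM⟩ := hf.exists_bound
  refine ⟨continuousOn_const.mul hf.continuousOn, ‖c‖ * M, fun x hx => ?_⟩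
  rw [norm_mul, mul_div_assoc]
  exact mul_le_mul_of_nonneg_left (hM x hx) (norm_nonneg _)

theorem sub (hf : HasQuadraticDecay f) (hg : HasQuadraticDecay g) :
    HasQuadraticDecay fun x => f x - g x := by
  simpa only [neg_one_mul, ← sub_eq_add_neg] using hf.add (hg.const_mul (-1))

theorem tendsto_zero (hf : HasQuadraticDecay f) : Tendsto f atTop (𝓝 0) := by
  obtain ⟨M, hM⟩ := hf.exists_bound
  have hlim : Tendsto (fun x : ℝ => M / (1 + x) ^ 2) atTop (𝓝 0) :=
    ((tendsto_pow_atTop two_ne_zero).comp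
      (tendsto_atTop_add_const_left _ 1 tendsto_id)).const_div_atTop M
  refine squeeze_zero_norm' ?_ hlim
  filter_upwards [eventually_gt_atTop 0] with x hx using hM x hx

theorem exp_mul (hf : HasQuadraticDecay f) {k : ℂ} (hk : k.im ≤ 0) :
    HasQuadraticDecay fun x => exp (-I * k * x) * f x := by
  obtain ⟨M, hM⟩ := hf.exists_bound
  refine ⟨ContinuousOn.mul (by fun_prop) hf.continuousOn, M, fun x hx => ?_⟩
  exact (norm_exp_neg_I_mul_mul_le hk hx.le _).trans (hM x hx)

theorem exp_neg : HasQuadraticDecay fun x => exp (-x : ℝ) := by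
  refine ⟨by fun_prop, 4, fun x hx => ?_⟩
  have hsq : (1 + x / 2) ^ 2 ≤ Real.exp x := by
    refine (pow_le_pow_left₀ (by positivity)
      (add_comm (x / 2) 1 ▸ Real.add_one_le_exp _) 2).trans_eq ?_
    rw [← Real.exp_nat_mul]
    congr 1
    push_cast
    ring
  rw [norm_exp_ofReal, Real.exp_neg, le_div_iff₀ (by positivity), inv_mul_le_iff₀ (Real.exp_pos x)]
  nlinarith

theorem norm_halfFourier_le (hf : HasQuadraticDecay f) {k : ℂ} (hk : k.im ≤ 0) :
    ‖halfFourier f k‖ ≤ ∫ x in Ioi (0 : ℝ), ‖f x‖ := by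
  refine (norm_integral_le_integral_norm _).trans ?_
  exact setIntegral_mono_on (hf.exp_mul hk).integrableOn.norm hf.integrableOn.norm
    measurableSet_Ioi fun x hx => norm_exp_neg_I_mul_mul_le hk (le_of_lt hx) _

theorem continuous_halfFourier (hf : HasQuadraticDecay f) :
    Continuous fun k : ℝ => halfFourier f k := by
  refine continuous_of_dominated (fun k : ℝ => ?_) (fun k => ?_) hf.integrableOn.norm
    (Eventually.of_forall fun x => by fun_prop)
  · exact (hf.exp_mul (ofReal_im k).le).integrableOn.aestronglyMeasurable
  · exact ae_restrict_of_forall_mem measurableSet_Ioi fun x hx =>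
      norm_exp_neg_I_mul_mul_le (ofReal_im k).le (le_of_lt hx) _

end HasQuadraticDecay

theorem mul_exp_neg_mul_le_inv {δ : ℝ} (hδ : 0 < δ) (x : ℝ) : x * Real.exp (-(δ * x)) ≤ δ⁻¹ := by
  rw [Real.exp_neg, ← div_eq_mul_inv, div_le_iff₀ (Real.exp_pos _), inv_mul_eq_div,
    le_div_iff₀ hδ, mul_comm]
  linarith [Real.add_one_le_exp (δ * x)]

theorem HasQuadraticDecay.differentiableAt_halfFourier {f : ℝ → ℂ} (hf : HasQuadraticDecay f)
    {k : ℂ} (hk : k.im < 0) : DifferentiableAt ℂ (halfFourier f) k := by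
  obtain ⟨δ, hkδ, hδ⟩ := exists_between (neg_pos.2 hk)
  have hnhds : {z : ℂ | z.im < -δ} ∈ 𝓝 k :=
    (isOpen_lt continuous_im continuous_const).mem_nhds (lt_neg_of_lt_neg hδ)
  refine (hasDerivAt_integral_of_dominated_loc_of_deriv_le (μ := volume.restrict (Ioi (0 : ℝ)))
    (F := fun (z : ℂ) (x : ℝ) => exp (-I * z * x) * f x)
    (F' := fun (z : ℂ) (x : ℝ) => exp (-I * z * x) * (-I * x) * f x)
    (bound := fun x => δ⁻¹ * ‖f x‖) hnhds ?_ (hf.exp_mul hk.le).integrableOn ?_ ?_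
    (hf.integrableOn.norm.const_mul _) ?_).2.differentiableAt
  · filter_upwards [hnhds] with z hz
    exact (hf.exp_mul (hz.trans (neg_neg_of_pos hkδ)).le).integrableOn.aestronglyMeasurable
  · exact (ContinuousOn.mul (by fun_prop) hf.continuousOn).aestronglyMeasurable measurableSet_Ioi
  · refine ae_restrict_of_forall_mem measurableSet_Ioi fun x hx z hz => ?_
    have hx' : 0 < x := hx
    have hexp : ‖exp (-I * z * x)‖ ≤ Real.exp (-(δ * x)) := by
      rw [norm_exp, Real.exp_le_exp, re_mul_ofReal, neg_mul, neg_re, I_mul_re, neg_neg, ← neg_mul]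
      exact mul_le_mul_of_nonneg_right (le_of_lt hz) hx'.le
    rw [norm_mul, norm_mul, norm_mul, norm_neg, norm_I, one_mul, norm_real,
      Real.norm_of_nonneg hx'.le, mul_comm ‖_‖ x]
    exact mul_le_mul_of_nonneg_right
      ((mul_le_mul_of_nonneg_left hexp hx'.le).trans (mul_exp_neg_mul_le_inv hkδ x)) (norm_nonneg _)
  · refine Eventually.of_forall fun x z _ => ?_
    have hlin : HasDerivAt (fun z : ℂ => -I * z * x) (-I * x) z := by
      simpa using ((hasDerivAt_id z).const_mul (-I)).mul_const (x : ℂ)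
    exact hlin.cexp.mul_const _

theorem halfFourier_congr {f g : ℝ → ℂ} (h : ∀ x, 0 < x → f x = g x) :
    halfFourier f = halfFourier g := by
  funext k
  exact setIntegral_congr_fun measurableSet_Ioi fun x hx => congrArg _ (h x hx)

theorem halfFourier_sub {f g : ℝ → ℂ} (hf : HasQuadraticDecay f) (hg : HasQuadraticDecay g)
    {k : ℂ} (hk : k.im ≤ 0) :
    halfFourier (fun x => f x - g x) k = halfFourier f k - halfFourier g k := by
  unfold halfFourier
  rw [← integral_sub (hf.exp_mul hk).integrableOn (hg.exp_mul hk).integrableOn]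
  simp only [mul_sub]

theorem halfFourier_const_mul (c : ℂ) (f : ℝ → ℂ) (k : ℂ) :
    halfFourier (fun x => c * f x) k = c * halfFourier f k := by
  simp only [halfFourier, ← integral_const_mul, mul_left_comm _ c]

theorem halfFourier_exp_neg {k : ℂ} (hk : k.im ≤ 0) :
    halfFourier (fun x => exp (-x : ℝ)) k = 1 / (1 + I * k) := by
  have hre : (-(1 + I * k)).re < 0 := by
    simp only [neg_re, add_re, one_re, I_mul_re]
    linarith
  have h := integral_exp_mul_complex_Ioi hre 0
  rw [ofReal_zero, mul_zero, exp_zero, neg_div_neg_eq] at h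
  rw [← h, halfFourier]
  congr 1 with x
  rw [← exp_add]
  congr 1
  push_cast
  ring

theorem halfFourier_deriv {f f' : ℝ → ℂ} (hf : HasQuadraticDecay f) (hf' : HasQuadraticDecay f')
    (hc : ContinuousWithinAt f (Ici 0) 0) (hd : ∀ x, 0 < x → HasDerivAt f (f' x) x) {k : ℂ}
    (hk : k.im ≤ 0) : halfFourier f' k = -f 0 + I * k * halfFourier f k := by
  have hexp : ∀ x : ℝ, HasDerivAt (fun x : ℝ => exp (-I * k * x))
      (exp (-I * k * x) * (-I * k)) x := fun x => by
    have hlin : HasDerivAt (fun x : ℝ => -I * k * (x : ℂ)) (-I * k) x := by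
      simpa using (ofRealCLM.hasDerivAt (x := x)).const_mul (-I * k)
    exact hlin.cexp
  have hint' := (hf'.exp_mul hk).integrableOn
  have hint := ((hf.exp_mul hk).integrableOn).const_mul (-I * k)
  have h := integral_Ioi_of_hasDerivAt_of_tendsto (f := fun x : ℝ => exp (-I * k * x) * f x)
    (f' := fun x => exp (-I * k * x) * f' x + (-I * k) * (exp (-I * k * x) * f x))
    (a := 0) (m := 0) (ContinuousWithinAt.mul (by fun_prop) hc)
    (fun x hx => ((hexp x).mul (hd x hx)).congr_deriv (by ring)) (hint'.add hint)
    (hf.exp_mul hk).tendsto_zero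
  rw [integral_add hint' hint, integral_const_mul] at h
  simp only [ofReal_zero, mul_zero, exp_zero, one_mul, zero_sub] at h
  unfold halfFourier
  linear_combination h

theorem fourier_indicator_Ioi (f : ℝ → ℂ) (w : ℝ) :
    FourierTransform.fourier ((Ioi (0 : ℝ)).indicator f) w =
      halfFourier f ((2 * Real.pi * w : ℝ) : ℂ) := by
  rw [Real.fourier_real_eq_integral_exp_smul, halfFourier, ← integral_indicator measurableSet_Ioi]
  congr 1 with v
  by_cases hv : v ∈ Ioi (0 : ℝ)
  · rw [indicator_of_mem hv, indicator_of_mem hv, smul_eq_mul]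
    congr 2
    push_cast
    ring
  · rw [indicator_of_notMem hv, indicator_of_notMem hv, smul_zero]

theorem integral_exp_mul_halfFourier {f : ℝ → ℂ} (hf : IntegrableOn f (Ioi 0))
    (hint : Integrable fun k : ℝ => halfFourier f k) {x : ℝ} (hx : 0 < x)
    (hc : ContinuousAt f x) :
    ∫ k : ℝ, exp (I * k * x) * halfFourier f k = 2 * Real.pi * f x := by
  have hfourier := fourier_indicator_Ioi f
  have hFint : Integrable (FourierTransform.fourier ((Ioi (0 : ℝ)).indicator f)) := by
    rw [funext hfourier]
    exact (integrable_comp_mul_left_iff _ Real.two_pi_pos.ne').2 hint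
  have hFc : ContinuousAt ((Ioi (0 : ℝ)).indicator f) x :=
    hc.congr (eqOn_indicator.eventuallyEq_of_mem (Ioi_mem_nhds hx)).symm
  have hinv := (hf.integrable_indicator measurableSet_Ioi).fourierInv_fourier_eq hFint hFc
  have hscale := Measure.integral_comp_mul_left
    (fun k : ℝ => exp (I * k * x) * halfFourier f k) (2 * Real.pi)
  rw [abs_of_pos (inv_pos.2 Real.two_pi_pos), eq_inv_smul_iff₀ Real.two_pi_pos.ne', real_smul]
    at hscale
  rw [Real.fourierInv_eq', indicator_of_mem (mem_Ioi.2 hx)] at hinv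
  rw [← hscale, ← hinv]
  push_cast
  congr 2 with v
  rw [hfourier, smul_eq_mul]
  congr 2
  · simp
    ring
  · push_cast
    rfl

theorem integrable_halfFourier_of_eq_zero {f f₁ f₂ : ℝ → ℂ} (hf : HasQuadraticDecay f)
    (hf₁ : HasQuadraticDecay f₁) (hf₂ : HasQuadraticDecay f₂)
    (hc : ContinuousWithinAt f (Ici 0) 0) (hc₁ : ContinuousWithinAt f₁ (Ici 0) 0)
    (hd : ∀ x, 0 < x → HasDerivAt f (f₁ x) x) (hd₁ : ∀ x, 0 < x → HasDerivAt f₁ (f₂ x) x)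
    (h0 : f 0 = 0) : Integrable fun k : ℝ => halfFourier f k := by
  have hint := integrable_div_one_add_sq
    ((hf.continuous_halfFourier.sub hf₂.continuous_halfFourier).sub
      (continuous_const (y := f₁ 0))) fun k => norm_sub_le_of_le (norm_sub_le_of_le
        (hf.norm_halfFourier_le (ofReal_im k).le) (hf₂.norm_halfFourier_le (ofReal_im k).le)) le_rfl
  refine hint.congr (Eventually.of_forall fun k => ?_)
  have hk := (ofReal_im k).le
  simp only [Pi.sub_apply]
  rw [halfFourier_deriv hf₁ hf₂ hc₁ hd₁ hk, halfFourier_deriv hf hf₁ hc hd hk, h0,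
    div_eq_iff (one_add_sq_ne_zero (ofReal_mem_closedPuncturedHalfPlane k))]
  linear_combination -((k : ℂ) ^ 2 * halfFourier f k) * I_sq

theorem hasImproperIntegral_exp_div_one_add_I_mul {x : ℝ} (hx : 0 < x) :
    HasImproperIntegral (fun k : ℝ => exp (I * k * x) * (1 / (1 + I * k)))
      (2 * Real.pi * exp (-x : ℝ)) := by
  obtain ⟨γ, hγ⟩ := exists_isContourAroundI
  have hdeforms : DeformsToRealLine γ fun k => exp (I * k * x) * (1 / (1 + I * k)) := by
    refine (((IsBoundedSymbol.exp_I_mul hx.le).deformsToRealLine_div_one_add_sq hγ).add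
      ((hγ.deformsToRealLine_exp_mul_div hx).const_mul (-1)) hγ).congr hγ fun k hk => ?_
    have hsq := one_add_sq_ne_zero hk
    have hne : 1 + I * k ≠ 0 := fun h => hsq (by linear_combination (1 - I * k) * h + k ^ 2 * I_sq)
    field_simp
    linear_combination -(k ^ 2) * I_sq
  convert hdeforms.hasImproperIntegral using 1
  have hexp : DifferentiableOn ℂ (fun k : ℂ => -I * exp (I * k * x)) {k | 0 < k.im} := by fun_prop
  rw [hγ.contourIntegral_congr (G := fun k => -I * exp (I * k * x) / (k - I)),
    hγ.contourIntegral_div_sub_I hexp]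
  · rw [I_mul_I]
    push_cast
    rw [neg_one_mul]
    linear_combination (2 * Real.pi * exp (-x)) * I_sq
  · intro k hk
    have hne : k - I ≠ 0 := sub_ne_zero.2 hk.2
    have hfactor : 1 + I * k = I * (k - I) := by linear_combination I_sq
    simp only [hfactor]
    field_simp
    linear_combination I_sq

theorem hasDerivAt_exp_neg (x : ℝ) :
    HasDerivAt (fun x : ℝ => exp (-x : ℝ)) (-exp (-x : ℝ)) x := by
  simpa using ((hasDerivAt_id x).neg.exp).ofReal_comp

/-- The transform of `f` decays only like `f(0) / (ik)`, so `f(0) e^{-x}` is split off. -/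
theorem hasImproperIntegral_exp_mul_halfFourier {f f₁ f₂ : ℝ → ℂ} (hf : HasQuadraticDecay f)
    (hf₁ : HasQuadraticDecay f₁) (hf₂ : HasQuadraticDecay f₂)
    (hc : ContinuousWithinAt f (Ici 0) 0) (hc₁ : ContinuousWithinAt f₁ (Ici 0) 0)
    (hd : ∀ x, 0 < x → HasDerivAt f (f₁ x) x) (hd₁ : ∀ x, 0 < x → HasDerivAt f₁ (f₂ x) x)
    {x : ℝ} (hx : 0 < x) :
    HasImproperIntegral (fun k : ℝ => exp (I * k * x) * halfFourier f k) (2 * Real.pi * f x) := by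
  have he : HasQuadraticDecay fun x => f 0 * exp (-x : ℝ) := .const_mul .exp_neg _
  have hce : ContinuousWithinAt (fun x => f 0 * exp (-x : ℝ)) (Ici 0) 0 := by fun_prop
  have hde : ∀ x : ℝ, HasDerivAt (fun x => f 0 * exp (-x : ℝ)) (-(f 0 * exp (-x : ℝ))) x :=
    fun x => ((hasDerivAt_exp_neg x).const_mul (f 0)).congr_deriv (mul_neg _ _)
  have hg := integrable_halfFourier_of_eq_zero (hf.sub he) (hf₁.add he) (hf₂.sub he)
    (hc.sub hce) (hc₁.add hce)
    (fun x hx => ((hd x hx).sub (hde x)).congr_deriv (sub_neg_eq_add _ _))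
    (fun x hx => ((hd₁ x hx).add (hde x)).congr_deriv (sub_eq_add_neg _ _).symm) (by simp)
  have hgx := integral_exp_mul_halfFourier (hf.sub he).integrableOn hg hx
    (((hd x hx).sub (hde x)).continuousAt)
  have hgint : Integrable fun k : ℝ =>
      exp (I * k * x) * halfFourier (fun x => f x - f 0 * exp (-x : ℝ)) k :=
    hg.bdd_mul (by fun_prop) (Eventually.of_forall fun k => (norm_exp_I_mul_ofReal_mul k x).le)
  convert (hasImproperIntegral_of_integrable hgint).add
    ((hasImproperIntegral_exp_div_one_add_I_mul hx).const_mul (f 0)) using 1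
  · ext k
    have hk := (ofReal_im k).le
    rw [halfFourier_sub hf he hk, halfFourier_const_mul, halfFourier_exp_neg hk]
    ring
  · rw [hgx]
    ring

/-- The closed quarter-plane `x ≥ 0`, `t ≥ 0`. -/
def quadrant : Set (ℝ × ℝ) := Ici 0 ×ˢ Ici 0

/-- Smoothness of `u` up to the boundary of the quarter-plane. -/
def IsSmoothOnQuadrant (u : ℝ → ℝ → ℂ) : Prop :=
  ContDiffOn ℝ ∞ (fun p : ℝ × ℝ => u p.1 p.2) quadrant

/-- The `x`-derivative of `u`, one-sided on the edges of the quarter-plane. -/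
def dX (u : ℝ → ℝ → ℂ) (x t : ℝ) : ℂ :=
  fderivWithin ℝ (fun p : ℝ × ℝ => u p.1 p.2) quadrant (x, t) (1, 0)

/-- The `t`-derivative of `u`, one-sided on the edges of the quarter-plane. -/
def dT (u : ℝ → ℝ → ℂ) (x t : ℝ) : ℂ :=
  fderivWithin ℝ (fun p : ℝ × ℝ => u p.1 p.2) quadrant (x, t) (0, 1)

theorem uniqueDiffOn_quadrant : UniqueDiffOn ℝ quadrant :=
  (uniqueDiffOn_Ici 0).prod (uniqueDiffOn_Ici 0)

theorem quadrant_subset_closure_interior : quadrant ⊆ closure (interior quadrant) := by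
  rw [quadrant, interior_prod_eq, closure_prod_eq, interior_Ici, closure_Ioi]

namespace IsSmoothOnQuadrant

variable {u : ℝ → ℝ → ℂ} (hu : IsSmoothOnQuadrant u)

include hu

protected theorem dX : IsSmoothOnQuadrant (dX u) :=
  (hu.fderivWithin uniqueDiffOn_quadrant (m := ∞) le_rfl).clm_apply contDiffOn_const

protected theorem dT : IsSmoothOnQuadrant (dT u) :=
  (hu.fderivWithin uniqueDiffOn_quadrant (m := ∞) le_rfl).clm_apply contDiffOn_const

theorem iterate_dX (a : ℕ) : IsSmoothOnQuadrant (dX^[a] u) := by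
  induction a with
  | zero => exact hu
  | succ a ih =>
    rw [Function.iterate_succ_apply']
    exact ih.dX

theorem iterate_dT (b : ℕ) : IsSmoothOnQuadrant (dT^[b] u) := by
  induction b with
  | zero => exact hu
  | succ b ih =>
    rw [Function.iterate_succ_apply']
    exact ih.dT

theorem continuousOn_fst {t : ℝ} (ht : 0 ≤ t) : ContinuousOn (fun x => u x t) (Ici 0) :=
  hu.continuousOn.comp (f := fun x : ℝ => (x, t)) (by fun_prop) fun _ hx => ⟨hx, ht⟩

theorem continuousOn_snd {x : ℝ} (hx : 0 ≤ x) : ContinuousOn (u x) (Ici 0) :=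
  hu.continuousOn.comp (f := fun t : ℝ => (x, t)) (by fun_prop) fun _ ht => ⟨hx, ht⟩

theorem hasFDerivWithinAt {x t : ℝ} (hx : 0 ≤ x) (ht : 0 ≤ t) :
    HasFDerivWithinAt (fun p : ℝ × ℝ => u p.1 p.2)
      (fderivWithin ℝ (fun p : ℝ × ℝ => u p.1 p.2) quadrant (x, t)) quadrant (x, t) :=
  (hu.differentiableOn (by simp) (x, t) ⟨hx, ht⟩).hasFDerivWithinAt

theorem hasDerivAt_dX {x t : ℝ} (hx : 0 < x) (ht : 0 ≤ t) :
    HasDerivAt (fun y => u y t) (LinearBoussinesq.dX u x t) x := by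
  have hline : HasDerivAt (fun y : ℝ => (y, t)) ((1 : ℝ), (0 : ℝ)) x :=
    (hasDerivAt_id x).prodMk (hasDerivAt_const x t)
  refine (hu.hasFDerivWithinAt hx.le ht).comp_hasDerivAt x hline ?_
  filter_upwards [Ioi_mem_nhds hx] with y hy
  exact ⟨mem_Ici.2 (le_of_lt hy), ht⟩

theorem hasDerivAt_dT {x t : ℝ} (hx : 0 ≤ x) (ht : 0 < t) :
    HasDerivAt (u x) (LinearBoussinesq.dT u x t) t := by
  have hline : HasDerivAt (fun s : ℝ => (x, s)) ((0 : ℝ), (1 : ℝ)) t :=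
    (hasDerivAt_const t x).prodMk (hasDerivAt_id t)
  refine (hu.hasFDerivWithinAt hx ht.le).comp_hasDerivAt t hline ?_
  filter_upwards [Ioi_mem_nhds ht] with s hs
  exact ⟨hx, mem_Ici.2 (le_of_lt hs)⟩

theorem dX_dT_comm {x t : ℝ} (hx : 0 ≤ x) (ht : 0 ≤ t) :
    LinearBoussinesq.dX (LinearBoussinesq.dT u) x t =
      LinearBoussinesq.dT (LinearBoussinesq.dX u) x t := by
  have hmem : (x, t) ∈ quadrant := ⟨hx, ht⟩
  have hfderiv : DifferentiableWithinAt ℝ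
      (fderivWithin ℝ (fun p : ℝ × ℝ => u p.1 p.2) quadrant) quadrant (x, t) :=
    (hu.fderivWithin uniqueDiffOn_quadrant (m := ∞) le_rfl).differentiableOn (by simp) _ hmem
  have hsecond : ∀ v w : ℝ × ℝ, fderivWithin ℝ
      (fun p => fderivWithin ℝ (fun p : ℝ × ℝ => u p.1 p.2) quadrant p v) quadrant (x, t) w =
      fderivWithin ℝ (fderivWithin ℝ (fun p : ℝ × ℝ => u p.1 p.2) quadrant) quadrant (x, t) w v :=
    fun v w => by
      rw [fderivWithin_clm_apply (uniqueDiffOn_quadrant _ hmem) hfderiv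
        (differentiableWithinAt_const v)]
      simp
  have htwo : minSmoothness ℝ 2 ≤ ∞ := by
    rw [minSmoothness_of_isRCLikeNormedField]
    exact WithTop.coe_le_coe.2 (le_top (a := (2 : ℕ∞)))
  have hsymm := (hu (x, t) hmem).isSymmSndFDerivWithinAt htwo uniqueDiffOn_quadrant
    (quadrant_subset_closure_interior hmem) hmem
  exact (hsecond _ _).trans ((hsymm _ _).trans (hsecond _ _).symm)

theorem iteratedDeriv_fst (a : ℕ) {x t : ℝ} (hx : 0 < x) (ht : 0 ≤ t) :
    iteratedDeriv a (fun y => u y t) x = LinearBoussinesq.dX^[a] u x t := by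
  induction a generalizing x with
  | zero => simp
  | succ a ih =>
    have hnear : iteratedDeriv a (fun y => u y t) =ᶠ[𝓝 x]
        fun y => LinearBoussinesq.dX^[a] u y t := by
      filter_upwards [Ioi_mem_nhds hx] with y hy using ih hy
    rw [iteratedDeriv_succ, Function.iterate_succ_apply', hnear.deriv_eq]
    exact ((hu.iterate_dX a).hasDerivAt_dX hx ht).deriv

theorem iteratedDeriv_snd (b : ℕ) {x t : ℝ} (hx : 0 ≤ x) (ht : 0 < t) :
    iteratedDeriv b (u x) t = LinearBoussinesq.dT^[b] u x t := by
  induction b generalizing t with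
  | zero => simp
  | succ b ih =>
    have hnear : iteratedDeriv b (u x) =ᶠ[𝓝 t] LinearBoussinesq.dT^[b] u x := by
      filter_upwards [Ioi_mem_nhds ht] with s hs using ih hs
    rw [iteratedDeriv_succ, Function.iterate_succ_apply', hnear.deriv_eq]
    exact ((hu.iterate_dT b).hasDerivAt_dT hx ht).deriv

theorem partialDeriv_eq (a b : ℕ) {x t : ℝ} (hx : 0 < x) (ht : 0 < t) :
    partialDeriv a b u x t = LinearBoussinesq.dT^[b] (LinearBoussinesq.dX^[a] u) x t := by
  have hnear : (fun s => iteratedDeriv a (fun y => u y s) x) =ᶠ[𝓝 t]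
      LinearBoussinesq.dX^[a] u x := by
    filter_upwards [Ioi_mem_nhds ht] with s hs using hu.iteratedDeriv_fst a hx (le_of_lt hs)
  rw [partialDeriv, hnear.iteratedDeriv_eq]
  exact (hu.iterate_dX a).iteratedDeriv_snd b hx.le ht

section Decay

variable (hdec : DecaysAtInfinity u)

include hdec

/-- The assumed decay is on `t > 0`; it extends to `t = 0` by continuity. -/
theorem exists_decay_bound (a b : ℕ) (T : ℝ) (ha : a ≤ 3 := by norm_num)
    (hb : b ≤ 1 := by norm_num) :
    ∃ M : ℝ, ∀ x t : ℝ, 0 < x → 0 ≤ t → t ≤ T →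
      ‖LinearBoussinesq.dT^[b] (LinearBoussinesq.dX^[a] u) x t‖ ≤ M / (1 + x) ^ 2 := by
  obtain ⟨M, hM⟩ := hdec a b ha hb (max T 1) (by positivity)
  refine ⟨M, fun x t hx ht htT => ?_⟩
  have hpos : ∀ s, 0 < s → s ≤ max T 1 →
      ‖LinearBoussinesq.dT^[b] (LinearBoussinesq.dX^[a] u) x s‖ ≤ M / (1 + x) ^ 2 := by
    intro s hs hsT
    rw [← hu.partialDeriv_eq a b hx hs]
    exact hM x s hx hs hsT
  rcases ht.eq_or_lt with rfl | ht
  · have hcont := (((hu.iterate_dX a).iterate_dT b).continuousOn_snd hx.le 0 self_mem_Ici).mono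
      Ioi_subset_Ici_self
    refine le_of_tendsto hcont.tendsto.norm ?_
    filter_upwards [Ioo_mem_nhdsGT one_pos] with s hs
    exact hpos s hs.1 (hs.2.le.trans (le_max_right _ _))
  · exact hpos t ht (htT.trans (le_max_left _ _))

theorem hasQuadraticDecay (a b : ℕ) {t : ℝ} (ht : 0 ≤ t) (ha : a ≤ 3 := by norm_num)
    (hb : b ≤ 1 := by norm_num) :
    HasQuadraticDecay fun x => LinearBoussinesq.dT^[b] (LinearBoussinesq.dX^[a] u) x t := by
  obtain ⟨M, hM⟩ := hu.exists_decay_bound hdec a b t ha hb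
  exact ⟨(((hu.iterate_dX a).iterate_dT b).continuousOn_fst ht).mono Ioi_subset_Ici_self, M,
    fun x hx => hM x t hx ht le_rfl⟩

theorem hasImproperIntegral {x t : ℝ} (hx : 0 < x) (ht : 0 ≤ t) :
    HasImproperIntegral (fun k : ℝ => exp (I * k * x) * halfFourier (fun y => u y t) k)
      (2 * Real.pi * u x t) :=
  hasImproperIntegral_exp_mul_halfFourier
    (hu.hasQuadraticDecay hdec 0 0 ht) (hu.hasQuadraticDecay hdec 1 0 ht)
    (hu.hasQuadraticDecay hdec 2 0 ht) (hu.continuousOn_fst ht 0 self_mem_Ici)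
    (hu.dX.continuousOn_fst ht 0 self_mem_Ici) (fun _ hy => hu.hasDerivAt_dX hy ht)
    (fun _ hy => hu.dX.hasDerivAt_dX hy ht) hx

theorem hasAbelIntegral {x t : ℝ} (hx : 0 < x) (ht : 0 ≤ t) :
    HasAbelIntegral (fun k : ℝ => exp (I * k * x) * halfFourier (fun y => u y t) k)
      (2 * Real.pi * u x t) := by
  have hut := hu.hasQuadraticDecay hdec 0 0 ht
  refine (hu.hasImproperIntegral hdec hx ht).hasAbelIntegral
    (Continuous.mul (by fun_prop) hut.continuous_halfFourier)
    (M := ∫ y in Ioi (0 : ℝ), ‖u y t‖) fun k => ?_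
  rw [norm_mul, norm_exp_I_mul_ofReal_mul, one_mul]
  exact hut.norm_halfFourier_le (ofReal_im k).le

theorem continuousOn_halfFourier {k : ℂ} (hk : k.im ≤ 0) (T : ℝ) :
    ContinuousOn (fun t => halfFourier (fun x => u x t) k) (Icc 0 T) := by
  obtain ⟨M, hM⟩ := hu.exists_decay_bound hdec 0 0 T
  refine continuousOn_of_dominated (bound := fun x => M / (1 + x) ^ 2) (fun t ht => ?_)
    (fun t ht => ?_) (integrableOn_div_one_add_sq M) ?_
  · exact ((hu.hasQuadraticDecay hdec 0 0 ht.1).exp_mul hk).integrableOn.aestronglyMeasurable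
  · exact ae_restrict_of_forall_mem measurableSet_Ioi fun x hx =>
      (norm_exp_neg_I_mul_mul_le hk (le_of_lt hx) _).trans (hM x t hx ht.1 ht.2)
  · exact ae_restrict_of_forall_mem measurableSet_Ioi fun x hx =>
      continuousOn_const.mul ((hu.continuousOn_snd (le_of_lt hx)).mono Icc_subset_Ici_self)

theorem hasDerivAt_halfFourier {k : ℂ} (hk : k.im ≤ 0) {t : ℝ} (ht : 0 < t) :
    HasDerivAt (fun t => halfFourier (fun x => u x t) k)
      (halfFourier (fun x => LinearBoussinesq.dT u x t) k) t := by
  obtain ⟨M, hM⟩ := hu.exists_decay_bound hdec 0 1 (t + 1)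
  refine (hasDerivAt_integral_of_dominated_loc_of_deriv_le (s := Ioo 0 (t + 1))
    (bound := fun x => M / (1 + x) ^ 2) (F := fun t x => exp (-I * k * x) * u x t)
    (F' := fun t x => exp (-I * k * x) * LinearBoussinesq.dT u x t)
    (Ioo_mem_nhds ht (lt_add_one t)) ?_ ?_ ?_ ?_ (integrableOn_div_one_add_sq M) ?_).2
  · filter_upwards [Ioi_mem_nhds ht] with s hs
    exact ((hu.hasQuadraticDecay hdec 0 0
      (le_of_lt hs)).exp_mul hk).integrableOn.aestronglyMeasurable
  · exact ((hu.hasQuadraticDecay hdec 0 0 ht.le).exp_mul hk).integrableOn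
  · exact ((hu.hasQuadraticDecay hdec 0 1 ht.le).exp_mul hk).integrableOn.aestronglyMeasurable
  · exact ae_restrict_of_forall_mem measurableSet_Ioi fun x hx s hs =>
      (norm_exp_neg_I_mul_mul_le hk (le_of_lt hx) _).trans (hM x s hx hs.1.le hs.2.le)
  · exact ae_restrict_of_forall_mem measurableSet_Ioi fun x hx s hs =>
      (hu.hasDerivAt_dT (le_of_lt hx) hs.1).const_mul _

end Decay

end IsSmoothOnQuadrant

/-- The flux `r - q_{xt}` of the momentum equation `q_t + (r - q_{xt})_x = 0`. Its trace at `x = 0`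
is the boundary value that the problem does not prescribe and that has to be eliminated. -/
def momentumFlux (r q : ℝ → ℝ → ℂ) (x t : ℝ) : ℂ := r x t - dT (dX q) x t

namespace IsSmoothSolution

variable {r₀ q₀ g₀ : ℝ → ℂ} {r q : ℝ → ℝ → ℂ} (hsol : IsSmoothSolution r₀ q₀ g₀ r q)

include hsol

theorem isSmoothOnQuadrant_r : IsSmoothOnQuadrant r := hsol.smooth_r

theorem isSmoothOnQuadrant_q : IsSmoothOnQuadrant q := hsol.smooth_q

theorem continuousOn_boundaryDatum : ContinuousOn (q 0) (Ici 0) :=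
  hsol.isSmoothOnQuadrant_q.continuousOn_snd le_rfl

theorem continuousOn_boundaryDeriv : ContinuousOn (dT q 0) (Ici 0) :=
  hsol.isSmoothOnQuadrant_q.dT.continuousOn_snd le_rfl

theorem continuousOn_boundaryFlux : ContinuousOn (momentumFlux r q 0) (Ici 0) :=
  (hsol.isSmoothOnQuadrant_r.continuousOn_snd le_rfl).sub
    (hsol.isSmoothOnQuadrant_q.dX.dT.continuousOn_snd le_rfl)

theorem deriv_boundaryDatum {t : ℝ} (ht : 0 < t) : deriv g₀ t = dT q 0 t := by
  refine ((hsol.isSmoothOnQuadrant_q.hasDerivAt_dT le_rfl ht).congr_of_eventuallyEq ?_).deriv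
  filter_upwards [Ioi_mem_nhds ht] with s hs using (hsol.bdry_q s (le_of_lt hs)).symm

theorem dT_r_eq {x t : ℝ} (hx : 0 < x) (ht : 0 < t) : dT r x t = -dX q x t := by
  have hpde := hsol.eq_r x t hx ht
  rw [hsol.isSmoothOnQuadrant_r.partialDeriv_eq 0 1 hx ht,
    hsol.isSmoothOnQuadrant_q.partialDeriv_eq 1 0 hx ht] at hpde
  exact eq_neg_of_add_eq_zero_left hpde

theorem hasDerivAt_momentumFlux {x t : ℝ} (hx : 0 < x) (ht : 0 < t) :
    HasDerivAt (fun y => momentumFlux r q y t) (-dT q x t) x := by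
  have hr := hsol.isSmoothOnQuadrant_r
  have hq := hsol.isSmoothOnQuadrant_q
  refine ((hr.hasDerivAt_dX hx ht.le).sub (hq.dX.dT.hasDerivAt_dX hx ht.le)).congr_deriv ?_
  have hpde : dT q x t + dX r x t - dT (dX (dX q)) x t = 0 := by
    have h := hsol.eq_q x t hx ht
    rwa [hq.partialDeriv_eq 0 1 hx ht, hr.partialDeriv_eq 1 0 hx ht,
      hq.partialDeriv_eq 2 1 hx ht] at h
  rw [hq.dX.dX_dT_comm hx.le ht.le]
  linear_combination hpde

section Transform

variable (hr : DecaysAtInfinity r) (hq : DecaysAtInfinity q) {k : ℂ} (hk : k.im ≤ 0) {t : ℝ}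
  (ht : 0 < t)

include hr hq hk ht

theorem hasDerivAt_halfFourier_r :
    HasDerivAt (fun t => halfFourier (fun x => r x t) k)
      (q 0 t - I * k * halfFourier (fun x => q x t) k) t := by
  have hqs := hsol.isSmoothOnQuadrant_q
  refine (hsol.isSmoothOnQuadrant_r.hasDerivAt_halfFourier hr hk ht).congr_deriv ?_
  have hdT : halfFourier (fun x => dT r x t) = halfFourier fun x => (-1) * dX q x t :=
    halfFourier_congr fun x hx => by rw [hsol.dT_r_eq hx ht, neg_one_mul]
  have hdX : halfFourier (fun x => dX q x t) k =
      -q 0 t + I * k * halfFourier (fun x => q x t) k :=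
    halfFourier_deriv (hqs.hasQuadraticDecay hq 0 0 ht.le) (hqs.hasQuadraticDecay hq 1 0 ht.le)
      (hqs.continuousOn_fst ht.le 0 self_mem_Ici) (fun x hx => hqs.hasDerivAt_dX hx ht.le) hk
  rw [hdT, halfFourier_const_mul, hdX]
  ring

theorem one_add_sq_mul_halfFourier_dT_q :
    (1 + k ^ 2) * halfFourier (fun x => dT q x t) k =
      momentumFlux r q 0 t - I * k * dT q 0 t - I * k * halfFourier (fun x => r x t) k := by
  have hrs := hsol.isSmoothOnQuadrant_r
  have hqs := hsol.isSmoothOnQuadrant_q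
  have hr₀ := hrs.hasQuadraticDecay hr 0 0 ht.le
  have hq₀₁ := hqs.hasQuadraticDecay hq 0 1 ht.le
  have hq₁₁ := hqs.hasQuadraticDecay hq 1 1 ht.le
  have hflux : halfFourier (fun x => (-1) * dT q x t) k = -momentumFlux r q 0 t +
      I * k * halfFourier (fun x => momentumFlux r q x t) k :=
    halfFourier_deriv (hr₀.sub hq₁₁) (hq₀₁.const_mul (-1))
      (((hrs.continuousOn_fst ht.le).sub (hqs.dX.dT.continuousOn_fst ht.le)) 0 self_mem_Ici)
      (fun x hx => (hsol.hasDerivAt_momentumFlux hx ht).congr_deriv (neg_one_mul _).symm) hk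
  have hdX : halfFourier (fun x => dT (dX q) x t) k =
      -dT q 0 t + I * k * halfFourier (fun x => dT q x t) k :=
    halfFourier_deriv hq₀₁ hq₁₁ (hqs.dT.continuousOn_fst ht.le 0 self_mem_Ici)
      (fun x hx => (hqs.dT.hasDerivAt_dX hx ht.le).congr_deriv (hqs.dX_dT_comm hx.le ht.le)) hk
  have hsub : halfFourier (fun x => momentumFlux r q x t) k =
      halfFourier (fun x => r x t) k - halfFourier (fun x => dT (dX q) x t) k :=
    halfFourier_sub hr₀ hq₁₁ hk
  rw [hsub, hdX, halfFourier_const_mul] at hflux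
  linear_combination -hflux + k ^ 2 * halfFourier (fun x => dT q x t) k * I_sq

theorem hasDerivAt_halfFourier_q (hk₀ : 1 + k ^ 2 ≠ 0) :
    HasDerivAt (fun t => halfFourier (fun x => q x t) k)
      ((momentumFlux r q 0 t - I * k * dT q 0 t - I * k * halfFourier (fun x => r x t) k) /
        (1 + k ^ 2)) t :=
  (hsol.isSmoothOnQuadrant_q.hasDerivAt_halfFourier hq hk ht).congr_deriv <|
    (eq_div_iff hk₀).2 <| (mul_comm _ _).trans <|
      hsol.one_add_sq_mul_halfFourier_dT_q hr hq hk ht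

end Transform

end IsSmoothSolution

theorem norm_mul_exp_angleFromBelow (z : ℂ) :
    (‖z‖ : ℂ) * exp (I * angleFromBelow z) = I * z := by
  have hangle : I * angleFromBelow z =
      arg (I * z) * I - toIcoDiv Real.two_pi_pos 0 (arg (I * z)) * (2 * Real.pi * I) := by
    rw [angleFromBelow, toIcoMod]
    push_cast
    ring
  have hpolar := norm_mul_exp_arg_mul_I (I * z)
  rwa [norm_mul, norm_I, one_mul, ← exp_periodic.sub_int_mul_eq, ← hangle] at hpolar

theorem mu_sq (k : ℂ) : mu k ^ 2 = 1 + k ^ 2 := by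
  have hfactor : 1 + k ^ 2 = (k + I) * (k - I) := by linear_combination I_sq
  have hsqrt : ((Real.sqrt ‖1 + k ^ 2‖ : ℝ) : ℂ) ^ 2 = (‖k + I‖ : ℂ) * ‖k - I‖ := by
    rw [← ofReal_pow, Real.sq_sqrt (norm_nonneg _), hfactor, norm_mul, ofReal_mul]
  have hphase :
      exp (I * ((angleFromBelow (k + I) + angleFromBelow (k - I) - Real.pi : ℝ) : ℂ) / 2) ^ 2 =
        -(exp (I * angleFromBelow (k + I)) * exp (I * angleFromBelow (k - I))) := by
    rw [← exp_nat_mul, ← exp_add, ← neg_one_mul, ← exp_neg_pi_mul_I, ← exp_add]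
    congr 1
    push_cast
    ring
  calc mu k ^ 2
      = -((‖k + I‖ : ℂ) * exp (I * angleFromBelow (k + I)) *
          ((‖k - I‖ : ℂ) * exp (I * angleFromBelow (k - I)))) := by
        rw [mu, mul_pow, hsqrt, hphase]
        ring
    _ = 1 + k ^ 2 := by
      rw [norm_mul_exp_angleFromBelow, norm_mul_exp_angleFromBelow]
      linear_combination (-k ^ 2 + I ^ 2 - 1) * I_sq

theorem mu_ne_zero {k : ℂ} (hk : 1 + k ^ 2 ≠ 0) : mu k ≠ 0 :=
  pow_ne_zero_iff two_ne_zero |>.1 <| mu_sq k ▸ hk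

theorem div_sq_eq_omegaSq {k μ : ℂ} (hμ : μ ^ 2 = 1 + k ^ 2) (hμ₀ : μ ≠ 0) :
    (k / μ) ^ 2 = omegaSq k := by
  have hk : 1 + k ^ 2 ≠ 0 := hμ ▸ pow_ne_zero 2 hμ₀
  rw [div_pow, hμ, omegaSq]
  field_simp
  ring

theorem omega_sq {k : ℂ} (hk : 1 + k ^ 2 ≠ 0) : omega k ^ 2 = omegaSq k :=
  div_sq_eq_omegaSq (mu_sq k) (mu_ne_zero hk)

theorem omega_div_mu (k : ℂ) : omega k / mu k = k / (1 + k ^ 2) := by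
  rw [omega, div_div, ← sq, mu_sq]

theorem expSum_eq (k : ℂ) (t : ℝ) : expSum k t = 2 * cos (omega k * t) := by
  rw [expSum, two_cos]
  congr 2 <;> ring

theorem expDiff_eq (k : ℂ) (t : ℝ) : expDiff k t = 2 * I * sin (omega k * t) := by
  have hsin := two_sin (omega k * t)
  rw [expDiff, show I * omega k * t = omega k * t * I by ring,
    show -I * omega k * t = -(omega k * t) * I by ring]
  linear_combination -I * hsin +
    (exp (omega k * t * I) - exp (-(omega k * t) * I)) * I_sq

theorem differentiable_tsum_pow {c : ℕ → ℂ} (hc : ∀ n, ‖c n‖ ≤ 1 / (n.factorial : ℝ)) :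
    Differentiable ℂ fun z : ℂ => ∑' n, c n * z ^ n := by
  intro z
  have hball : IsOpen (Metric.ball (0 : ℂ) (‖z‖ + 1)) := Metric.isOpen_ball
  refine (differentiableOn_tsum_of_summable_norm (F := fun n (w : ℂ) => c n * w ^ n)
    (Real.summable_pow_div_factorial (‖z‖ + 1)) (fun n => by fun_prop) hball
    fun n w hw => ?_).differentiableAt (hball.mem_nhds (by simp))
  rw [mem_ball_zero_iff] at hw
  calc ‖c n * w ^ n‖ = ‖c n‖ * ‖w‖ ^ n := by rw [norm_mul, norm_pow]
    _ ≤ 1 / (n.factorial : ℝ) * (‖z‖ + 1) ^ n := by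
      gcongr
      exact hc n
    _ = (‖z‖ + 1) ^ n / (n.factorial : ℝ) := by ring

/-- The entire function with `cosSqrt (s ^ 2) = cos s`. -/
def cosSqrt (z : ℂ) : ℂ := ∑' n : ℕ, (-1) ^ n / ((2 * n).factorial : ℂ) * z ^ n

/-- The entire function with `s * sincSqrt (s ^ 2) = sin s`. -/
def sincSqrt (z : ℂ) : ℂ := ∑' n : ℕ, (-1) ^ n / ((2 * n + 1).factorial : ℂ) * z ^ n

theorem differentiable_cosSqrt : Differentiable ℂ cosSqrt := by
  refine differentiable_tsum_pow fun n => ?_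
  rw [norm_div, norm_pow, norm_neg, norm_one, one_pow, norm_natCast]
  have hle : n.factorial ≤ (2 * n).factorial := Nat.factorial_le (by lia)
  gcongr

theorem differentiable_sincSqrt : Differentiable ℂ sincSqrt := by
  refine differentiable_tsum_pow fun n => ?_
  rw [norm_div, norm_pow, norm_neg, norm_one, one_pow, norm_natCast]
  have hle : n.factorial ≤ (2 * n + 1).factorial := Nat.factorial_le (by lia)
  gcongr

theorem cosSqrt_sq (s : ℂ) : cosSqrt (s ^ 2) = cos s := by
  rw [cosSqrt, ← (Complex.hasSum_cos s).tsum_eq]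
  refine tsum_congr fun n => ?_
  rw [← pow_mul]
  ring

theorem mul_sincSqrt_sq (s : ℂ) : s * sincSqrt (s ^ 2) = sin s := by
  rw [sincSqrt, ← (Complex.hasSum_sin s).tsum_eq, ← tsum_mul_left]
  refine tsum_congr fun n => ?_
  rw [← pow_mul]
  ring

/-- The convolution `∫₀ᵗ C(z (t - τ)²) φ(τ) dτ`, in which the frequency enters only through its
square `z`. -/
def entireConv (C : ℂ → ℂ) (φ : ℝ → ℂ) (t : ℝ) (z : ℂ) : ℂ :=
  ∫ τ in (0 : ℝ)..t, C (z * ((t : ℂ) - τ) ^ 2) * φ τ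

/-- The entire function of `z = ω²` with `ω * sincConv φ t (ω ^ 2) = ∫₀ᵗ sin(ω (t - τ)) φ(τ) dτ`. -/
def sincConv (φ : ℝ → ℂ) (t : ℝ) (z : ℂ) : ℂ :=
  entireConv sincSqrt (fun τ => ((t : ℂ) - τ) * φ τ) t z

section EntireConv

variable {C : ℂ → ℂ} (hC : Differentiable ℂ C) {φ ψ : ℝ → ℂ} {t : ℝ}
  (hφ : IntervalIntegrable φ volume 0 t)

theorem intervalIntegrable_sub_mul (hφ : IntervalIntegrable φ volume 0 t) :
    IntervalIntegrable (fun τ : ℝ => ((t : ℂ) - τ) * φ τ) volume 0 t :=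
  hφ.continuousOn_mul (by fun_prop)

theorem entireConv_const_mul (C : ℂ → ℂ) (c : ℂ) (φ : ℝ → ℂ) (t : ℝ) (z : ℂ) :
    entireConv C (fun τ => c * φ τ) t z = c * entireConv C φ t z := by
  simp only [entireConv, mul_left_comm _ c, intervalIntegral.integral_const_mul]

theorem sincConv_const_mul (c : ℂ) (φ : ℝ → ℂ) (t : ℝ) (z : ℂ) :
    sincConv (fun τ => c * φ τ) t z = c * sincConv φ t z := by
  simp only [sincConv, mul_left_comm _ c, entireConv_const_mul]

include hφ

theorem entireConv_sub (hC : Continuous C) (hψ : IntervalIntegrable ψ volume 0 t) (z : ℂ) :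
    entireConv C (fun τ => φ τ - ψ τ) t z = entireConv C φ t z - entireConv C ψ t z := by
  have hkernel : ContinuousOn (fun τ : ℝ => C (z * ((t : ℂ) - τ) ^ 2)) (uIcc 0 t) := by fun_prop
  simp only [entireConv, mul_sub]
  exact intervalIntegral.integral_sub (hφ.continuousOn_mul hkernel) (hψ.continuousOn_mul hkernel)

theorem sincConv_sub (hψ : IntervalIntegrable ψ volume 0 t) (z : ℂ) :
    sincConv (fun τ => φ τ - ψ τ) t z = sincConv φ t z - sincConv ψ t z := by
  simp only [sincConv, mul_sub]
  exact entireConv_sub (intervalIntegrable_sub_mul hφ) differentiable_sincSqrt.continuous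
    (intervalIntegrable_sub_mul hψ) z

include hC in
theorem differentiable_entireConv : Differentiable ℂ (entireConv C φ t) := by
  intro z
  have hCc : Continuous C := hC.continuous
  have hC'c : Continuous (deriv C) := (hC.contDiff (n := 1)).continuous_deriv le_rfl
  set K : ℂ → ℝ → ℂ := fun w τ => deriv C (w * ((t : ℂ) - τ) ^ 2) * ((t : ℂ) - τ) ^ 2
  have hKc : Continuous fun p : ℂ × ℝ => K p.1 p.2 := by fun_prop
  obtain ⟨M, hM⟩ := ((isCompact_closedBall z 1).prod
    (isCompact_uIcc (a := (0 : ℝ)) (b := t))).exists_bound_of_continuousOn hKc.continuousOn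
  have hφm := (intervalIntegrable_iff.1 hφ).aestronglyMeasurable
  refine (intervalIntegral.hasDerivAt_integral_of_dominated_loc_of_deriv_le
    (F := fun w τ => C (w * ((t : ℂ) - τ) ^ 2) * φ τ) (F' := fun w τ => K w τ * φ τ)
    (bound := fun τ => M * ‖φ τ‖) (Metric.ball_mem_nhds z one_pos)
    (Eventually.of_forall fun w => (Continuous.aestronglyMeasurable (by fun_prop)).mul hφm)
    (hφ.continuousOn_mul (Continuous.continuousOn (by fun_prop)))
    ((hKc.comp (by fun_prop : Continuous fun τ : ℝ => (z, τ))).aestronglyMeasurable.mul hφm)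
    ?_ (hφ.norm.const_mul M) ?_).2.differentiableAt
  · refine Eventually.of_forall fun τ hτ w hw => ?_
    rw [norm_mul]
    exact mul_le_mul_of_nonneg_right
      (hM (w, τ) ⟨Metric.ball_subset_closedBall hw, uIoc_subset_uIcc hτ⟩) (norm_nonneg _)
  · refine Eventually.of_forall fun τ _ w _ => ?_
    have harg : HasDerivAt (fun w : ℂ => w * ((t : ℂ) - τ) ^ 2) (((t : ℂ) - τ) ^ 2) w := by
      simpa using (hasDerivAt_id w).mul_const (((t : ℂ) - τ) ^ 2)
    exact ((hC _).hasDerivAt.comp w harg).mul_const (φ τ)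

theorem differentiable_entireConv_cosSqrt : Differentiable ℂ (entireConv cosSqrt φ t) :=
  differentiable_entireConv differentiable_cosSqrt hφ

theorem differentiable_sincConv : Differentiable ℂ (sincConv φ t) :=
  differentiable_entireConv differentiable_sincSqrt (intervalIntegrable_sub_mul hφ)

end EntireConv

theorem integral_cos_mul_eq_entireConv (φ : ℝ → ℂ) (w : ℂ) (t : ℝ) :
    ∫ τ in (0 : ℝ)..t, cos (w * ((t : ℂ) - τ)) * φ τ = entireConv cosSqrt φ t (w ^ 2) := by
  simp only [entireConv, ← mul_pow, cosSqrt_sq]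

theorem integral_sin_mul_eq_sincConv (φ : ℝ → ℂ) (w : ℂ) (t : ℝ) :
    ∫ τ in (0 : ℝ)..t, sin (w * ((t : ℂ) - τ)) * φ τ = w * sincConv φ t (w ^ 2) := by
  rw [sincConv, entireConv, ← intervalIntegral.integral_const_mul]
  refine intervalIntegral.integral_congr fun τ _ => ?_
  simp only [← mul_sincSqrt_sq (w * ((t : ℂ) - τ)), mul_pow]
  ring

section Kernels

variable {φ : ℝ → ℂ} {t : ℝ}

theorem intervalIntegrable_cos_mul (hφ : IntervalIntegrable φ volume 0 t) (w : ℂ) :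
    IntervalIntegrable (fun τ : ℝ => cos (w * ((t : ℂ) - τ)) * φ τ) volume 0 t :=
  hφ.continuousOn_mul (by fun_prop)

theorem intervalIntegrable_sin_mul (hφ : IntervalIntegrable φ volume 0 t) (w : ℂ) :
    IntervalIntegrable (fun τ : ℝ => sin (w * ((t : ℂ) - τ)) * φ τ) volume 0 t :=
  hφ.continuousOn_mul (by fun_prop)

theorem exp_mul_timeTransform (hφ : IntervalIntegrable φ volume 0 t) (w : ℂ) :
    exp (I * w * t) * timeTransform φ w t =
      entireConv cosSqrt φ t (w ^ 2) + I * (w * sincConv φ t (w ^ 2)) := by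
  rw [timeTransform, ← integral_cos_mul_eq_entireConv, ← integral_sin_mul_eq_sincConv,
    ← intervalIntegral.integral_const_mul, ← intervalIntegral.integral_const_mul,
    ← intervalIntegral.integral_add (intervalIntegrable_cos_mul hφ w)
      ((intervalIntegrable_sin_mul hφ w).const_mul I)]
  refine intervalIntegral.integral_congr fun τ _ => ?_
  rw [← mul_assoc, ← exp_add, show I * w * t + -I * w * τ = w * ((t : ℂ) - τ) * I by ring,
    exp_mul_I]
  ring

theorem exp_neg_mul_timeTransform_neg (hφ : IntervalIntegrable φ volume 0 t) (w : ℂ) :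
    exp (-I * w * t) * timeTransform φ (-w) t =
      entireConv cosSqrt φ t (w ^ 2) - I * (w * sincConv φ t (w ^ 2)) := by
  have h := exp_mul_timeTransform hφ (-w)
  rw [neg_sq] at h
  rw [neg_mul_comm I w]
  linear_combination h

theorem transSum_eq (hφ : IntervalIntegrable φ volume 0 t) {k : ℂ} (hk : 1 + k ^ 2 ≠ 0) :
    transSum φ k t = 2 * entireConv cosSqrt φ t (omegaSq k) := by
  rw [transSum, exp_mul_timeTransform hφ, exp_neg_mul_timeTransform_neg hφ, omega_sq hk]
  ring

theorem transDiff_eq (hφ : IntervalIntegrable φ volume 0 t) {k : ℂ} (hk : 1 + k ^ 2 ≠ 0) :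
    transDiff φ k t = 2 * I * (omega k * sincConv φ t (omegaSq k)) := by
  rw [transDiff, exp_mul_timeTransform hφ, exp_neg_mul_timeTransform_neg hφ, omega_sq hk]
  ring

theorem timeTransform_congr {ψ : ℝ → ℂ} (ht : 0 ≤ t) (h : ∀ τ, 0 < τ → φ τ = ψ τ) (w : ℂ) :
    timeTransform φ w t = timeTransform ψ w t := by
  refine intervalIntegral.integral_congr_ae (Eventually.of_forall fun τ hτ => ?_)
  rw [uIoc_of_le ht] at hτ
  simp only [h τ hτ.1]

end Kernels

/-- Duhamel's formula: the first component of the solution of the symmetric system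
`R' = F - iωS`, `S' = H - iωR`. -/
theorem eq_cos_mul_sub_sin_mul_add_conv {R S F H : ℝ → ℂ} {w : ℂ} {t : ℝ} (ht : 0 ≤ t)
    (hR : ContinuousOn R (Icc 0 t)) (hS : ContinuousOn S (Icc 0 t))
    (hF : ContinuousOn F (Icc 0 t)) (hH : ContinuousOn H (Icc 0 t))
    (hR' : ∀ τ, 0 < τ → HasDerivAt R (F τ - I * w * S τ) τ)
    (hS' : ∀ τ, 0 < τ → HasDerivAt S (H τ - I * w * R τ) τ) :
    R t = cos (w * t) * R 0 - I * sin (w * t) * S 0 +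
      (entireConv cosSqrt F t (w ^ 2) - I * (w * sincConv H t (w ^ 2))) := by
  have harg : ∀ τ : ℝ, HasDerivAt (fun τ : ℝ => w * ((t : ℂ) - τ)) (-w) τ := fun τ => by
    simpa using ((ofRealCLM.hasDerivAt (x := τ)).const_sub (t : ℂ)).const_mul w
  have hcos := intervalIntegrable_cos_mul (hF.intervalIntegrable_of_Icc ht) w
  have hsin := (intervalIntegrable_sin_mul (hH.intervalIntegrable_of_Icc ht) w).const_mul I
  have hftc := intervalIntegral.integral_eq_sub_of_hasDerivAt_of_le ht
    (f := fun τ : ℝ => cos (w * ((t : ℂ) - τ)) * R τ - I * (sin (w * ((t : ℂ) - τ)) * S τ))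
    (f' := fun τ : ℝ => cos (w * ((t : ℂ) - τ)) * F τ - I * (sin (w * ((t : ℂ) - τ)) * H τ))
    ((ContinuousOn.mul (by fun_prop) hR).sub
      (continuousOn_const.mul (ContinuousOn.mul (by fun_prop) hS)))
    (fun τ hτ => by
      refine ((((hasDerivAt_cos _).comp τ (harg τ)).mul (hR' τ hτ.1)).sub
        ((((hasDerivAt_sin _).comp τ (harg τ)).mul (hS' τ hτ.1)).const_mul I)).congr_deriv ?_
      simp only [Function.comp_apply]
      linear_combination (w * sin (w * ((t : ℂ) - τ)) * R τ) * I_sq)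
    (hcos.sub hsin)
  rw [intervalIntegral.integral_sub hcos hsin, intervalIntegral.integral_const_mul,
    integral_cos_mul_eq_entireConv, integral_sin_mul_eq_sincConv] at hftc
  simp only [sub_self, mul_zero, Complex.cos_zero, Complex.sin_zero, one_mul, zero_mul, sub_zero,
    ofReal_zero] at hftc
  linear_combination -hftc

/-- The coefficient of the prescribed boundary values `g` and `g₁` in `r̂(k, t)`, as a function of
`ω²`. -/
def dataSymbolR (g g₁ : ℝ → ℂ) (t : ℝ) (z : ℂ) : ℂ :=
  entireConv cosSqrt g t z - z * sincConv g₁ t z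

/-- The coefficient of `-ik / (1 + k²)` contributed by the prescribed boundary values `g` and `g₁`
to `q̂(k, t)`, as a function of `ω²`. -/
def dataSymbolQ (g g₁ : ℝ → ℂ) (t : ℝ) (z : ℂ) : ℂ :=
  entireConv cosSqrt g₁ t z + sincConv g t z

theorem dataSymbolR_one {g g₁ : ℝ → ℂ} {t : ℝ} (ht : 0 ≤ t) (hg : ContinuousOn g (Icc 0 t))
    (hg₁ : ContinuousOn g₁ (Icc 0 t)) (hderiv : ∀ τ, 0 < τ → HasDerivAt g (g₁ τ) τ) :
    dataSymbolR g g₁ t 1 = sin t * g 0 := by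
  -- `R = 0`, `S = g` solves the system of Duhamel's formula at frequency `1`.
  have hduhamel := eq_cos_mul_sub_sin_mul_add_conv (R := fun _ => 0) (S := g)
    (F := fun τ => I * g τ) (H := g₁) (w := 1) ht continuousOn_const hg
    (continuousOn_const.mul hg) hg₁
    (fun τ _ => (hasDerivAt_const τ (0 : ℂ)).congr_deriv (by ring))
    (fun τ hτ => (hderiv τ hτ).congr_deriv (by ring))
  rw [entireConv_const_mul] at hduhamel
  refine mul_left_cancel₀ I_ne_zero ?_
  rw [dataSymbolR]
  simp only [one_pow, one_mul, mul_zero, zero_sub] at hduhamel ⊢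
  linear_combination -hduhamel

/-- The part of `r̂(k, t)` that is generated by the boundary values `q`, `q_t` and `r - q_{xt}` at
`x = 0`. -/
def boundaryPartR (r q : ℝ → ℝ → ℂ) (t : ℝ) : ℂ → ℂ :=
  boundaryForm (dataSymbolR (q 0) (dT q 0) t) (sincConv (momentumFlux r q 0) t) 0

/-- The part of `q̂(k, t)` that is generated by the boundary values `q`, `q_t` and `r - q_{xt}` at
`x = 0`. -/
def boundaryPartQ (r q : ℝ → ℝ → ℂ) (t : ℝ) : ℂ → ℂ :=
  boundaryForm 0 (dataSymbolQ (q 0) (dT q 0) t) (entireConv cosSqrt (momentumFlux r q 0) t)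

namespace IsSmoothSolution

variable {r₀ q₀ g₀ : ℝ → ℂ} {r q : ℝ → ℝ → ℂ} (hsol : IsSmoothSolution r₀ q₀ g₀ r q)

include hsol

theorem halfFourier_init_r : halfFourier r₀ = halfFourier fun x => r x 0 :=
  halfFourier_congr fun x hx => (hsol.init_r x hx.le).symm

theorem halfFourier_init_q : halfFourier q₀ = halfFourier fun x => q x 0 :=
  halfFourier_congr fun x hx => (hsol.init_q x hx.le).symm

section Time

variable {t : ℝ} (ht : 0 ≤ t)

include ht

theorem intervalIntegrable_boundaryDatum : IntervalIntegrable (q 0) volume 0 t :=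
  (hsol.continuousOn_boundaryDatum.mono Icc_subset_Ici_self).intervalIntegrable_of_Icc ht

theorem intervalIntegrable_boundaryDeriv : IntervalIntegrable (dT q 0) volume 0 t :=
  (hsol.continuousOn_boundaryDeriv.mono Icc_subset_Ici_self).intervalIntegrable_of_Icc ht

theorem intervalIntegrable_boundaryFlux : IntervalIntegrable (momentumFlux r q 0) volume 0 t :=
  (hsol.continuousOn_boundaryFlux.mono Icc_subset_Ici_self).intervalIntegrable_of_Icc ht

theorem differentiable_dataSymbolR : Differentiable ℂ (dataSymbolR (q 0) (dT q 0) t) :=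
  (differentiable_entireConv_cosSqrt (hsol.intervalIntegrable_boundaryDatum ht)).sub
    (differentiable_id.mul (differentiable_sincConv (hsol.intervalIntegrable_boundaryDeriv ht)))

theorem differentiable_dataSymbolQ : Differentiable ℂ (dataSymbolQ (q 0) (dT q 0) t) :=
  (differentiable_entireConv_cosSqrt (hsol.intervalIntegrable_boundaryDeriv ht)).add
    (differentiable_sincConv (hsol.intervalIntegrable_boundaryDatum ht))

theorem differentiable_fluxSymbolR : Differentiable ℂ (sincConv (momentumFlux r q 0) t) :=
  differentiable_sincConv (hsol.intervalIntegrable_boundaryFlux ht)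

theorem differentiable_fluxSymbolQ :
    Differentiable ℂ (entireConv cosSqrt (momentumFlux r q 0) t) :=
  differentiable_entireConv_cosSqrt (hsol.intervalIntegrable_boundaryFlux ht)

theorem dataSymbolR_boundary_one : dataSymbolR (q 0) (dT q 0) t 1 = sin t * q₀ 0 := by
  rw [dataSymbolR_one ht (hsol.continuousOn_boundaryDatum.mono Icc_subset_Ici_self)
    (hsol.continuousOn_boundaryDeriv.mono Icc_subset_Ici_self)
    fun τ hτ => hsol.isSmoothOnQuadrant_q.hasDerivAt_dT le_rfl hτ, hsol.init_q 0 le_rfl]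

variable (hr : DecaysAtInfinity r) (hq : DecaysAtInfinity q) {k μ : ℂ} (hk : k.im ≤ 0)
  (hμ : μ ^ 2 = 1 + k ^ 2) (hμ₀ : μ ≠ 0)

include hr hq hk hμ hμ₀

/-- `r̂` and `μ q̂` solve a symmetric system. The sign of `μ` is immaterial, so the formula can be
used at `k` and at `-k` with the same `ω = k / μ`. -/
theorem halfFourier_r_eq : halfFourier (fun x => r x t) k =
    cos (k / μ * t) * halfFourier r₀ k - I * sin (k / μ * t) * (μ * halfFourier q₀ k) +
      boundaryPartR r q t k := by
  have hk₀ : 1 + k ^ 2 ≠ 0 := hμ ▸ pow_ne_zero 2 hμ₀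
  have hg₁ : ContinuousOn (dT q 0) (Icc 0 t) :=
    hsol.continuousOn_boundaryDeriv.mono Icc_subset_Ici_self
  have hh : ContinuousOn (momentumFlux r q 0) (Icc 0 t) :=
    hsol.continuousOn_boundaryFlux.mono Icc_subset_Ici_self
  have hduhamel := eq_cos_mul_sub_sin_mul_add_conv (w := k / μ)
    (R := fun τ => halfFourier (fun x => r x τ) k)
    (S := fun τ => μ * halfFourier (fun x => q x τ) k) (F := q 0)
    (H := fun τ => μ⁻¹ * (momentumFlux r q 0 τ - I * k * dT q 0 τ)) ht
    (hsol.isSmoothOnQuadrant_r.continuousOn_halfFourier hr hk t)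
    (continuousOn_const.mul (hsol.isSmoothOnQuadrant_q.continuousOn_halfFourier hq hk t))
    (hsol.continuousOn_boundaryDatum.mono Icc_subset_Ici_self)
    (continuousOn_const.mul (hh.sub (continuousOn_const.mul hg₁)))
    (fun τ hτ => (hsol.hasDerivAt_halfFourier_r hr hq hk hτ).congr_deriv (by field_simp))
    (fun τ hτ => ((hsol.hasDerivAt_halfFourier_q hr hq hk hτ hk₀).const_mul μ).congr_deriv (by
      rw [← hμ]
      field_simp))
  rw [hsol.halfFourier_init_r, hsol.halfFourier_init_q, hduhamel, div_sq_eq_omegaSq hμ hμ₀,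
    sincConv_const_mul, sincConv_sub (hsol.intervalIntegrable_boundaryFlux ht)
      ((hsol.intervalIntegrable_boundaryDeriv ht).const_mul _), sincConv_const_mul,
    boundaryPartR, boundaryForm, dataSymbolR, ← div_sq_eq_omegaSq hμ hμ₀, ← hμ]
  simp only [Pi.zero_apply, zero_mul, add_zero]
  field_simp
  linear_combination (k ^ 2 * sincConv (dT q 0) t (k ^ 2 / μ ^ 2)) * I_sq

theorem halfFourier_q_eq : halfFourier (fun x => q x t) k =
    cos (k / μ * t) * halfFourier q₀ k - I * sin (k / μ * t) * (μ⁻¹ * halfFourier r₀ k) +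
      boundaryPartQ r q t k := by
  have hk₀ : 1 + k ^ 2 ≠ 0 := hμ ▸ pow_ne_zero 2 hμ₀
  have hg₁ : ContinuousOn (dT q 0) (Icc 0 t) :=
    hsol.continuousOn_boundaryDeriv.mono Icc_subset_Ici_self
  have hh : ContinuousOn (momentumFlux r q 0) (Icc 0 t) :=
    hsol.continuousOn_boundaryFlux.mono Icc_subset_Ici_self
  have hduhamel := eq_cos_mul_sub_sin_mul_add_conv (w := k / μ)
    (R := fun τ => halfFourier (fun x => q x τ) k)
    (S := fun τ => μ⁻¹ * halfFourier (fun x => r x τ) k)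
    (F := fun τ => (μ ^ 2)⁻¹ * (momentumFlux r q 0 τ - I * k * dT q 0 τ))
    (H := fun τ => μ⁻¹ * q 0 τ) ht
    (hsol.isSmoothOnQuadrant_q.continuousOn_halfFourier hq hk t)
    (continuousOn_const.mul (hsol.isSmoothOnQuadrant_r.continuousOn_halfFourier hr hk t))
    (continuousOn_const.mul (hh.sub (continuousOn_const.mul hg₁)))
    (continuousOn_const.mul (hsol.continuousOn_boundaryDatum.mono Icc_subset_Ici_self))
    (fun τ hτ => (hsol.hasDerivAt_halfFourier_q hr hq hk hτ hk₀).congr_deriv (by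
      rw [← hμ]
      field_simp))
    (fun τ hτ => ((hsol.hasDerivAt_halfFourier_r hr hq hk hτ).const_mul μ⁻¹).congr_deriv (by
      field_simp))
  rw [hsol.halfFourier_init_r, hsol.halfFourier_init_q, hduhamel, div_sq_eq_omegaSq hμ hμ₀,
    sincConv_const_mul, entireConv_const_mul,
    entireConv_sub (hsol.intervalIntegrable_boundaryFlux ht) differentiable_cosSqrt.continuous
      ((hsol.intervalIntegrable_boundaryDeriv ht).const_mul _), entireConv_const_mul,
    boundaryPartQ, boundaryForm, dataSymbolQ, ← hμ]
  simp only [Pi.zero_apply, zero_sub]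
  field_simp
  ring

end Time

end IsSmoothSolution

theorem boundaryForm_neg (A B E : ℂ → ℂ) (k : ℂ) :
    boundaryForm A B E (-k) = boundaryForm A (-B) E k := by
  simp only [boundaryForm, omegaSq, neg_sq, Pi.neg_apply]
  ring

theorem IsBoundedSymbol.boundaryForm_neg {A B E : ℂ → ℂ} (hA : Differentiable ℂ A)
    (hB : Differentiable ℂ B) (hE : Differentiable ℂ E) :
    IsBoundedSymbol fun k => LinearBoussinesq.boundaryForm A B E (-k) := by
  simpa only [LinearBoussinesq.boundaryForm_neg] using IsBoundedSymbol.boundaryForm hA hB.neg hE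

theorem IsBoundedSymbol.continuousOn_exp_mul {Φ : ℂ → ℂ} (hΦ : IsBoundedSymbol Φ) (x : ℝ) :
    ContinuousOn (fun k => exp (I * k * x) * Φ k) puncturedHalfPlane :=
  ContinuousOn.mul (by fun_prop) (hΦ.continuousOn.mono puncturedHalfPlane_subset_closed)

section Reflection

variable {γ : ℝ → ℂ} (hγ : IsContourAroundI γ) {f : ℝ → ℂ} (hf : HasQuadraticDecay f)

include hf

theorem HasQuadraticDecay.differentiableOn_exp_mul_halfFourier_neg (x : ℝ) :
    DifferentiableOn ℂ (fun k => exp (I * k * x) * halfFourier f (-k)) {k | 0 < k.im} := by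
  intro k hk
  have hneg : (-k).im < 0 := by
    rw [neg_im]
    exact neg_neg_of_pos hk
  have hdiff := (hf.differentiableAt_halfFourier hneg).comp k differentiableAt_id.neg
  exact (DifferentiableAt.mul (by fun_prop) hdiff).differentiableWithinAt

include hγ

theorem IsContourAroundI.contourIntegral_exp_mul_halfFourier_neg_sub {Φ : ℂ → ℂ}
    (hΦ : IsBoundedSymbol Φ) (x : ℝ) :
    contourIntegral γ (fun k => exp (I * k * x) * (halfFourier f (-k) - Φ k)) =
      -contourIntegral γ fun k => exp (I * k * x) * Φ k := by
  have hf' := hf.differentiableOn_exp_mul_halfFourier_neg x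
  have hadd := hγ.contourIntegral_add (G := fun k => -1 * (exp (I * k * x) * Φ k))
    (hf'.continuousOn.mono sdiff_subset)
    (continuousOn_const.mul (hΦ.continuousOn_exp_mul x))
  rw [hγ.contourIntegral_eq_zero_of_differentiableOn hf', zero_add, contourIntegral_const_mul,
    neg_one_mul] at hadd
  rw [← hadd]
  congr 1 with k
  ring

end Reflection

section Inversion

variable {u : ℝ → ℝ → ℂ} (hu : IsSmoothOnQuadrant u) (hdec : DecaysAtInfinity u)
  {γ : ℝ → ℂ} (hγ : IsContourAroundI γ) {x t : ℝ} (hx : 0 < x) (ht : 0 ≤ t)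
  {A B E : ℂ → ℂ} (hA : Differentiable ℂ A) (hB : Differentiable ℂ B) (hE : Differentiable ℂ E)

include hu hdec hγ hx ht hA hB hE

theorem IsSmoothOnQuadrant.hasImproperIntegral_sub_boundaryForm (hA₁ : A 1 = 0) :
    HasImproperIntegral
      (fun k : ℝ => exp (I * k * x) * (halfFourier (fun y => u y t) k - boundaryForm A B E k))
      (2 * Real.pi * u x t -
        contourIntegral γ fun k => exp (I * k * x) * boundaryForm A B E k) := by
  have h := (hu.hasImproperIntegral hdec hx ht).sub
    (hγ.hasImproperIntegral_boundaryForm_sub hA hB hE hx)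
  simpa only [hA₁, sub_zero, ← mul_sub] using h

/-- The limit `A 1` of the boundary form at infinity leaves a multiple of `e^{ikx}`, whose integral
vanishes in the sense of Abel only. -/
theorem IsSmoothOnQuadrant.hasAbelIntegral_sub_boundaryForm :
    HasAbelIntegral
      (fun k : ℝ => exp (I * k * x) * (halfFourier (fun y => u y t) k - boundaryForm A B E k))
      (2 * Real.pi * u x t -
        contourIntegral γ fun k => exp (I * k * x) * boundaryForm A B E k) := by
  have hΦ : IsBoundedSymbol fun k => exp (I * k * x) * (boundaryForm A B E k - A 1) :=
    (IsBoundedSymbol.exp_I_mul hx.le).mul ((IsBoundedSymbol.boundaryForm hA hB hE).sub (.const _))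
  obtain ⟨M, hM⟩ := hΦ.exists_bound_ofReal
  have h := ((hu.hasAbelIntegral hdec hx ht).sub
    ((hγ.hasImproperIntegral_boundaryForm_sub hA hB hE hx).hasAbelIntegral
      hΦ.continuous_ofReal hM)).sub ((hasAbelIntegral_exp hx.ne').const_mul (A 1))
  rw [mul_zero, sub_zero] at h
  convert h using 1
  ext k
  ring

end Inversion

namespace IsSmoothSolution

variable {r₀ q₀ g₀ : ℝ → ℂ} {r q : ℝ → ℝ → ℂ} (hsol : IsSmoothSolution r₀ q₀ g₀ r q)
  {t : ℝ} (ht : 0 ≤ t)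

include hsol ht

theorem isBoundedSymbol_boundaryPartR : IsBoundedSymbol (boundaryPartR r q t) :=
  .boundaryForm (hsol.differentiable_dataSymbolR ht) (hsol.differentiable_fluxSymbolR ht)
    (differentiable_const 0)

theorem isBoundedSymbol_boundaryPartQ : IsBoundedSymbol (boundaryPartQ r q t) :=
  .boundaryForm (differentiable_const 0) (hsol.differentiable_dataSymbolQ ht)
    (hsol.differentiable_fluxSymbolQ ht)

theorem isBoundedSymbol_boundaryPartR_neg : IsBoundedSymbol fun k => boundaryPartR r q t (-k) :=
  .boundaryForm_neg (hsol.differentiable_dataSymbolR ht) (hsol.differentiable_fluxSymbolR ht)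
    (differentiable_const 0)

theorem isBoundedSymbol_boundaryPartQ_neg : IsBoundedSymbol fun k => boundaryPartQ r q t (-k) :=
  .boundaryForm_neg (differentiable_const 0) (hsol.differentiable_dataSymbolQ ht)
    (hsol.differentiable_fluxSymbolQ ht)

section TimeTransforms

variable {k : ℂ} (hk : 1 + k ^ 2 ≠ 0)

include hk

theorem transSum_boundaryDatum :
    transSum g₀ k t = 2 * entireConv cosSqrt (q 0) t (omegaSq k) := by
  rw [← transSum_eq (hsol.intervalIntegrable_boundaryDatum ht) hk]
  simp only [transSum, timeTransform_congr ht fun τ hτ => (hsol.bdry_q τ (le_of_lt hτ)).symm]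

theorem transDiff_boundaryDatum :
    transDiff g₀ k t = 2 * I * (omega k * sincConv (q 0) t (omegaSq k)) := by
  rw [← transDiff_eq (hsol.intervalIntegrable_boundaryDatum ht) hk]
  simp only [transDiff, timeTransform_congr ht fun τ hτ => (hsol.bdry_q τ (le_of_lt hτ)).symm]

theorem transSum_deriv_boundaryDatum :
    transSum (deriv g₀) k t = 2 * entireConv cosSqrt (dT q 0) t (omegaSq k) := by
  rw [← transSum_eq (hsol.intervalIntegrable_boundaryDeriv ht) hk]
  simp only [transSum, timeTransform_congr ht fun _ hτ => hsol.deriv_boundaryDatum hτ]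

theorem transDiff_deriv_boundaryDatum :
    transDiff (deriv g₀) k t = 2 * I * (omega k * sincConv (dT q 0) t (omegaSq k)) := by
  rw [← transDiff_eq (hsol.intervalIntegrable_boundaryDeriv ht) hk]
  simp only [transDiff, timeTransform_congr ht fun _ hτ => hsol.deriv_boundaryDatum hτ]

/-- The unknown boundary flux cancels, since `ω²` is even and `k / (1 + k²)` is odd. -/
theorem transSum_add_transDiff_eq :
    transSum g₀ k t + I * omega k * transDiff (deriv g₀) k t =
      boundaryPartR r q t k + boundaryPartR r q t (-k) := by
  rw [hsol.transSum_boundaryDatum ht hk, hsol.transDiff_deriv_boundaryDatum ht hk,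
    boundaryPartR, boundaryForm_neg]
  simp only [boundaryForm, dataSymbolR, Pi.zero_apply, Pi.neg_apply]
  linear_combination 2 * omega k ^ 2 * sincConv (dT q 0) t (omegaSq k) * I_sq -
    2 * sincConv (dT q 0) t (omegaSq k) * omega_sq hk

theorem transDiff_add_transSum_eq :
    1 / mu k * transDiff g₀ k t + I * k / (1 + k ^ 2) * transSum (deriv g₀) k t =
      boundaryPartQ r q t (-k) - boundaryPartQ r q t k := by
  rw [hsol.transDiff_boundaryDatum ht hk, hsol.transSum_deriv_boundaryDatum ht hk,
    boundaryPartQ, boundaryForm_neg]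
  simp only [boundaryForm, dataSymbolQ, Pi.zero_apply, Pi.neg_apply]
  linear_combination 2 * I * sincConv (q 0) t (omegaSq k) * omega_div_mu k

end TimeTransforms

section BoundaryData

variable {γ : ℝ → ℂ} (hγ : IsContourAroundI γ) (x : ℝ)

include hγ

theorem contourIntegral_boundaryData_r :
    contourIntegral γ (fun k => exp (I * k * x) *
        (transSum g₀ k t + I * omega k * transDiff (deriv g₀) k t)) =
      contourIntegral γ (fun k => exp (I * k * x) * boundaryPartR r q t k) +
        contourIntegral γ fun k => exp (I * k * x) * boundaryPartR r q t (-k) := by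
  rw [← hγ.contourIntegral_add ((hsol.isBoundedSymbol_boundaryPartR ht).continuousOn_exp_mul x)
    ((hsol.isBoundedSymbol_boundaryPartR_neg ht).continuousOn_exp_mul x)]
  refine hγ.contourIntegral_congr fun k hk => ?_
  rw [hsol.transSum_add_transDiff_eq ht
    (one_add_sq_ne_zero (puncturedHalfPlane_subset_closed hk)), mul_add]

theorem contourIntegral_boundaryData_q :
    contourIntegral γ (fun k => exp (I * k * x) *
        (1 / mu k * transDiff g₀ k t + I * k / (1 + k ^ 2) * transSum (deriv g₀) k t)) =
      contourIntegral γ (fun k => exp (I * k * x) * boundaryPartQ r q t (-k)) -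
        contourIntegral γ fun k => exp (I * k * x) * boundaryPartQ r q t k := by
  have hcongr : EqOn (fun k => exp (I * k * x) *
      (1 / mu k * transDiff g₀ k t + I * k / (1 + k ^ 2) * transSum (deriv g₀) k t))
      (fun k => exp (I * k * x) * (boundaryPartQ r q t (-k) - boundaryPartQ r q t k))
      puncturedHalfPlane := fun k hk => by
    simp only [hsol.transDiff_add_transSum_eq ht
      (one_add_sq_ne_zero (puncturedHalfPlane_subset_closed hk))]
  rw [hγ.contourIntegral_congr hcongr, eq_sub_iff_add_eq, ← hγ.contourIntegral_add _
    ((hsol.isBoundedSymbol_boundaryPartQ ht).continuousOn_exp_mul x)]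
  · simp only [← mul_add, sub_add_cancel]
  · exact (((hsol.isBoundedSymbol_boundaryPartQ_neg ht).sub
      (hsol.isBoundedSymbol_boundaryPartQ ht)).continuousOn_exp_mul x)

end BoundaryData

variable (hr : DecaysAtInfinity r) (hq : DecaysAtInfinity q)

include hr hq

section InitialData

variable {k : ℂ} (hk₀ : 1 + k ^ 2 ≠ 0)

include hk₀

theorem initialPart_r_eq (hk : k.im ≤ 0) :
    1 / 2 * (expSum k t * halfFourier r₀ k - mu k * expDiff k t * halfFourier q₀ k) =
      halfFourier (fun x => r x t) k - boundaryPartR r q t k := by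
  rw [hsol.halfFourier_r_eq ht hr hq hk (mu_sq k) (mu_ne_zero hk₀), ← omega, expSum_eq,
    expDiff_eq]
  ring

theorem initialPart_q_eq (hk : k.im ≤ 0) :
    1 / 2 * (expSum k t * halfFourier q₀ k - 1 / mu k * expDiff k t * halfFourier r₀ k) =
      halfFourier (fun x => q x t) k - boundaryPartQ r q t k := by
  rw [hsol.halfFourier_q_eq ht hr hq hk (mu_sq k) (mu_ne_zero hk₀), ← omega, expSum_eq,
    expDiff_eq]
  ring

/-- The branch of `(1 + k²)^{1/2}` to take at `-k` is `-μ(k)`, which leaves `ω` unchanged. -/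
theorem initialPart_neg_r_eq (hk : 0 ≤ k.im) :
    1 / 2 * (expSum k t * halfFourier r₀ (-k) + mu k * expDiff k t * halfFourier q₀ (-k)) =
      halfFourier (fun x => r x t) (-k) - boundaryPartR r q t (-k) := by
  rw [hsol.halfFourier_r_eq ht hr hq (k := -k) (μ := -mu k) (by simpa using hk)
    (by rw [neg_sq, neg_sq, mu_sq]) (neg_ne_zero.2 (mu_ne_zero hk₀)), neg_div_neg_eq, ← omega,
    expSum_eq, expDiff_eq]
  ring

theorem initialPart_neg_q_eq (hk : 0 ≤ k.im) :
    1 / 2 * (expSum k t * halfFourier q₀ (-k) + 1 / mu k * expDiff k t * halfFourier r₀ (-k)) =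
      halfFourier (fun x => q x t) (-k) - boundaryPartQ r q t (-k) := by
  rw [hsol.halfFourier_q_eq ht hr hq (k := -k) (μ := -mu k) (by simpa using hk)
    (by rw [neg_sq, neg_sq, mu_sq]) (neg_ne_zero.2 (mu_ne_zero hk₀)), neg_div_neg_eq, ← omega,
    expSum_eq, expDiff_eq]
  ring

end InitialData

variable {γ : ℝ → ℂ} (hγ : IsContourAroundI γ) (x : ℝ)

include hγ

theorem contourIntegral_initialPart_r :
    contourIntegral γ (fun k => exp (I * k * x) * (1 / 2) *
        (expSum k t * halfFourier r₀ (-k) + mu k * expDiff k t * halfFourier q₀ (-k))) =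
      -contourIntegral γ fun k => exp (I * k * x) * boundaryPartR r q t (-k) := by
  rw [← hγ.contourIntegral_exp_mul_halfFourier_neg_sub
    (hsol.isSmoothOnQuadrant_r.hasQuadraticDecay hr 0 0 ht)
    (hsol.isBoundedSymbol_boundaryPartR_neg ht) x]
  refine hγ.contourIntegral_congr fun k hk => ?_
  have hk' := puncturedHalfPlane_subset_closed hk
  rw [mul_assoc, hsol.initialPart_neg_r_eq ht hr hq (one_add_sq_ne_zero hk') hk'.1]
  rfl

theorem contourIntegral_initialPart_q :
    contourIntegral γ (fun k => exp (I * k * x) * (1 / 2) *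
        (expSum k t * halfFourier q₀ (-k) + 1 / mu k * expDiff k t * halfFourier r₀ (-k))) =
      -contourIntegral γ fun k => exp (I * k * x) * boundaryPartQ r q t (-k) := by
  rw [← hγ.contourIntegral_exp_mul_halfFourier_neg_sub
    (hsol.isSmoothOnQuadrant_q.hasQuadraticDecay hq 0 0 ht)
    (hsol.isBoundedSymbol_boundaryPartQ_neg ht) x]
  refine hγ.contourIntegral_congr fun k hk => ?_
  have hk' := puncturedHalfPlane_subset_closed hk
  rw [mul_assoc, hsol.initialPart_neg_q_eq ht hr hq (one_add_sq_ne_zero hk') hk'.1]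
  rfl

variable {x} (hx : 0 < x)

include hx

theorem hasAbelIntegral_r :
    HasAbelIntegral (fun k : ℝ => exp (I * k * x) * (1 / 2) *
        (expSum k t * halfFourier r₀ k - mu k * expDiff k t * halfFourier q₀ k))
      (2 * Real.pi * r x t -
        contourIntegral γ fun k => exp (I * k * x) * boundaryPartR r q t k) := by
  have hreal (k : ℝ) := hsol.initialPart_r_eq ht hr hq
    (one_add_sq_ne_zero (ofReal_mem_closedPuncturedHalfPlane k)) (ofReal_im k).le
  simp only [mul_assoc (exp _), hreal]
  exact hsol.isSmoothOnQuadrant_r.hasAbelIntegral_sub_boundaryForm hr hγ hx ht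
    (hsol.differentiable_dataSymbolR ht) (hsol.differentiable_fluxSymbolR ht)
    (differentiable_const 0)

theorem hasImproperIntegral_r (h₀ : q₀ 0 * Real.sin t = 0) :
    HasImproperIntegral (fun k : ℝ => exp (I * k * x) * (1 / 2) *
        (expSum k t * halfFourier r₀ k - mu k * expDiff k t * halfFourier q₀ k))
      (2 * Real.pi * r x t -
        contourIntegral γ fun k => exp (I * k * x) * boundaryPartR r q t k) := by
  have hreal (k : ℝ) := hsol.initialPart_r_eq ht hr hq
    (one_add_sq_ne_zero (ofReal_mem_closedPuncturedHalfPlane k)) (ofReal_im k).le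
  simp only [mul_assoc (exp _), hreal]
  refine hsol.isSmoothOnQuadrant_r.hasImproperIntegral_sub_boundaryForm hr hγ hx ht
    (hsol.differentiable_dataSymbolR ht) (hsol.differentiable_fluxSymbolR ht)
    (differentiable_const 0) ?_
  rw [hsol.dataSymbolR_boundary_one ht, ← ofReal_sin, mul_comm, h₀]

theorem hasImproperIntegral_q :
    HasImproperIntegral (fun k : ℝ => exp (I * k * x) * (1 / 2) *
        (expSum k t * halfFourier q₀ k - 1 / mu k * expDiff k t * halfFourier r₀ k))
      (2 * Real.pi * q x t -
        contourIntegral γ fun k => exp (I * k * x) * boundaryPartQ r q t k) := by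
  have hreal (k : ℝ) := hsol.initialPart_q_eq ht hr hq
    (one_add_sq_ne_zero (ofReal_mem_closedPuncturedHalfPlane k)) (ofReal_im k).le
  simp only [mul_assoc (exp _), hreal]
  exact hsol.isSmoothOnQuadrant_q.hasImproperIntegral_sub_boundaryForm hq hγ hx ht
    (differentiable_const 0) (hsol.differentiable_dataSymbolQ ht)
    (hsol.differentiable_fluxSymbolQ ht) rfl

end IsSmoothSolution

end LinearBoussinesq

end

theorem mainTheorem2 (r₀ q₀ g₀ : ℝ → ℂ) (r q : ℝ → ℝ → ℂ)
    (hsol : LinearBoussinesq.IsSmoothSolution r₀ q₀ g₀ r q)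
    (hr : LinearBoussinesq.DecaysAtInfinity r) (hq : LinearBoussinesq.DecaysAtInfinity q)
    (γ : ℝ → ℂ) (hγ : LinearBoussinesq.IsContourAroundI γ)
    (x t : ℝ) (hx : 0 < x) (ht : 0 ≤ t) :
    (∃ J : ℂ,
      LinearBoussinesq.HasAbelIntegral (fun k : ℝ => Complex.exp (Complex.I * k * x) * (1 / 2) *
        (LinearBoussinesq.expSum k t * LinearBoussinesq.halfFourier r₀ k -
          LinearBoussinesq.mu k * LinearBoussinesq.expDiff k t *
            LinearBoussinesq.halfFourier q₀ k)) J ∧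
      (q₀ 0 * Real.sin t = 0 →
        LinearBoussinesq.HasImproperIntegral
          (fun k : ℝ => Complex.exp (Complex.I * k * x) * (1 / 2) *
            (LinearBoussinesq.expSum k t * LinearBoussinesq.halfFourier r₀ k -
              LinearBoussinesq.mu k * LinearBoussinesq.expDiff k t *
                LinearBoussinesq.halfFourier q₀ k)) J) ∧
      r x t = 1 / (2 * Real.pi) * J
        + 1 / (2 * Real.pi) * LinearBoussinesq.contourIntegral γ (fun k =>
            Complex.exp (Complex.I * k * x) * (1 / 2) *
              (LinearBoussinesq.expSum k t * LinearBoussinesq.halfFourier r₀ (-k) +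
                LinearBoussinesq.mu k * LinearBoussinesq.expDiff k t *
                  LinearBoussinesq.halfFourier q₀ (-k)))
        + 1 / (2 * Real.pi) * LinearBoussinesq.contourIntegral γ (fun k =>
            Complex.exp (Complex.I * k * x) *
              (LinearBoussinesq.transSum g₀ k t +
                Complex.I * LinearBoussinesq.omega k *
                  LinearBoussinesq.transDiff (deriv g₀) k t))) ∧
    (∃ J : ℂ,
      LinearBoussinesq.HasImproperIntegral
        (fun k : ℝ => Complex.exp (Complex.I * k * x) * (1 / 2) *
          (LinearBoussinesq.expSum k t * LinearBoussinesq.halfFourier q₀ k -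
            1 / LinearBoussinesq.mu k * LinearBoussinesq.expDiff k t *
              LinearBoussinesq.halfFourier r₀ k)) J ∧
      q x t = 1 / (2 * Real.pi) * J
        - 1 / (2 * Real.pi) * LinearBoussinesq.contourIntegral γ (fun k =>
            Complex.exp (Complex.I * k * x) * (1 / 2) *
              (LinearBoussinesq.expSum k t * LinearBoussinesq.halfFourier q₀ (-k) +
                1 / LinearBoussinesq.mu k * LinearBoussinesq.expDiff k t *
                  LinearBoussinesq.halfFourier r₀ (-k)))
        - 1 / (2 * Real.pi) * LinearBoussinesq.contourIntegral γ (fun k =>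
            Complex.exp (Complex.I * k * x) *
              (1 / LinearBoussinesq.mu k * LinearBoussinesq.transDiff g₀ k t +
                Complex.I * k / (1 + k ^ 2) *
                  LinearBoussinesq.transSum (deriv g₀) k t))) := by
  have hπ : 1 / (2 * Real.pi : ℂ) * (2 * Real.pi) = 1 :=
    one_div_mul_cancel (mul_ne_zero two_ne_zero (ofReal_ne_zero.2 Real.pi_ne_zero))
  refine ⟨⟨_, hsol.hasAbelIntegral_r ht hr hq hγ hx,
    hsol.hasImproperIntegral_r ht hr hq hγ hx, ?_⟩,
    ⟨_, hsol.hasImproperIntegral_q ht hr hq hγ hx, ?_⟩⟩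
  · rw [hsol.contourIntegral_initialPart_r ht hr hq hγ,
      hsol.contourIntegral_boundaryData_r ht hγ]
    linear_combination -(r x t) * hπ
  · rw [hsol.contourIntegral_initialPart_q ht hr hq hγ,
      hsol.contourIntegral_boundaryData_q ht hγ]
    linear_combination -(q x t) * hπ
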